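/- **Setting.** Let $\sigma>0$ and let $h:\mathbb{R}\to\mathbb{R}$ be even and such that the series $$w(\xi)=\sum_{j\in\mathbb{Z}}\Big[h\Big(\frac{j+\frac12+\xi}{\sigma}\Big)-h\Big(\frac{j+\frac12}{\sigma}\Big)\Big]$$ converges absolutely for every $\xi\in\mathbb{R}$, $w\in C^3(\mathbb{R})$, $w(\xi)>0$ for $\xi\notin\mathbb{Z}$, and $w''(z)>0$ for $z\in\mathbb{Z}$ (then $w$ is $1$-periodic and vanishes exactly on $\mathbb{Z}$). Put $\bar p=2\int_0^1\sqrt{w(s)}\,ds$. Let $m_l\neq m_r$ be integers and let $v\in C^1(\mathbb{R})$ be strictly monotone with $v(x)\to m_r$ as $x\to\infty$, $v(x)\to m_l$ as $x\to-\infty$, $m_r-v\in L^1\cap L^2([0,\infty))$, $v-m_l\in L^1\cap L^2((-\infty,0])$ and $v'\in L^1\cap L^2(\mathbb{R})$. Let $\bar C>0$ and $$\bar A=\{\xi:\ \xi-v\in L^1(\mathbb{R}),\ \|\xi-v\|_{L^1(\mathbb{R})}\le\bar C\},$$ where convergence in $\bar A$ means convergence in $L^1_{\rm loc}(\mathbb{R})$.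 For $\varepsilon,\delta>0$ define $E_{\varepsilon,\delta}:\bar A\to[0,\infty]$ by $$E_{\varepsilon,\delta}[\xi]=\varepsilon\int_{\mathbb{R}}\xi'(x)^2\,dx+\varepsilon^{-1}\int_{\mathbb{R}}w(\xi(x))\,dx$$ if $\xi\in\bar A$ is continuous and affine on each interval $[i\varepsilon\delta,(i+1)\varepsilon\delta]$, $i\in\mathbb{Z}$, and $E_{\varepsilon,\delta}[\xi]=\infty$ for all other $\xi\in\bar A$. Let $BV(\mathbb{R};\mathbb{Z})$ denote the locally integrable functions that are integer-valued a.e. and have finite total variation $\operatorname{Var}(\xi,\mathbb{R})=\sup\{\int\xi\varphi':\varphi\in C^1_c(\mathbb{R}),\ |\varphi|\le1\}$, and define $E:\bar A\to[0,\infty]$ by $E[\xi]=\bar p\operatorname{Var}(\xi,\mathbb{R})$ if $\xi\in\bar A\cap BV(\mathbb{R};\mathbb{Z})$ and $E[\xi]=\infty$ otherwise. **Theorem.** Let $\varepsilon_n,\delta_n>0$ with $\varepsilon_n\to0$ and $\delta_n\to0$. Then $E_{\varepsilon_n,\delta_n}$ $\Gamma$-converges to $E$ in $\bar A$ with respect to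 $L^1_{\rm loc}(\mathbb{R})$ convergence; that is, for every $\xi\in\bar A$: 1. for every sequence $(\xi_n)\subset\bar A$ with $\xi_n\to\xi$ in $L^1_{\rm loc}(\mathbb{R})$, $E[\xi]\le\liminf_{n\to\infty}E_{\varepsilon_n,\delta_n}[\xi_n]$; 2. there is a sequence $(\xi_n)\subset\bar A$ with $\xi_n\to\xi$ in $L^1_{\rm loc}(\mathbb{R})$ and $\limsup_{n\to\infty}E_{\varepsilon_n,\delta_n}[\xi_n]\le E[\xi]$. Moreover (compactness), if $C>0$, $(\xi_n)\subset\bar A$ and $E_{\varepsilon_n,\delta_n}[\xi_n]\le C$ for all $n$, then a subsequence of $(\xi_n)$ converges in $L^1_{\rm loc}(\mathbb{R})$ to some $\xi^*\in\bar A\cap BV(\mathbb{R};\mathbb{Z})$. -/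

import Mathlib

open MeasureTheory Filter Topology
open scoped ENNReal

namespace DomainWall

/-- The weak-interaction potential generated by the pair interaction `h` with length scale `σ`:
`w(ξ) = ∑_{j ∈ ℤ} [h((j + 1/2 + ξ)/σ) - h((j + 1/2)/σ)]`. -/
noncomputable def potential (h : ℝ → ℝ) (σ : ℝ) (ξ : ℝ) : ℝ :=
  ∑' j : ℤ, (h (((j : ℝ) + 1 / 2 + ξ) / σ) - h (((j : ℝ) + 1 / 2) / σ))

/-- Standing assumptions on the pair interaction: `σ > 0`, `h` is even, the series defining the
potential `w` converges at every point, `w` is of class `C³`, `w > 0` off the integers and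
`w'' > 0` at the integers. (Periodicity of `w` and `w = 0` on `ℤ` follow and are not assumed.) -/
structure IsAdmissibleInteraction (h : ℝ → ℝ) (σ : ℝ) : Prop where
  sigma_pos : 0 < σ
  even : ∀ x, h (-x) = h x
  summable : ∀ ξ : ℝ, Summable fun j : ℤ =>
    h (((j : ℝ) + 1 / 2 + ξ) / σ) - h (((j : ℝ) + 1 / 2) / σ)
  contDiff : ContDiff ℝ 3 (potential h σ)
  pos : ∀ ξ : ℝ, (∀ z : ℤ, ξ ≠ z) → 0 < potential h σ ξ
  second_deriv_pos : ∀ z : ℤ, 0 < iteratedDeriv 2 (potential h σ) z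

/-- `p(z) = 2 ∫₀ᶻ √w(t) dt`. -/
noncomputable def primitive (w : ℝ → ℝ) (z : ℝ) : ℝ :=
  2 * ∫ t in (0 : ℝ)..z, Real.sqrt (w t)

/-- The reference profile `v`: continuously differentiable, strictly monotone, with limits `ml` at
`-∞` and `mr` at `+∞`, where `mr - v` and `v - ml` are in `L¹ ∩ L²` near `+∞` and `-∞`
respectively, and `v' ∈ L¹(ℝ) ∩ L²(ℝ)`. -/
structure IsProfile (ml mr : ℤ) (v : ℝ → ℝ) : Prop where
  contDiff : ContDiff ℝ 1 v
  strictly_monotone : StrictMono v ∨ StrictAnti v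
  tendsto_right : Tendsto v atTop (𝓝 (mr : ℝ))
  tendsto_left : Tendsto v atBot (𝓝 (ml : ℝ))
  right_L1 : MemLp (fun x => (mr : ℝ) - v x) 1 (volume.restrict (Set.Ici 0))
  right_L2 : MemLp (fun x => (mr : ℝ) - v x) 2 (volume.restrict (Set.Ici 0))
  left_L1 : MemLp (fun x => v x - (ml : ℝ)) 1 (volume.restrict (Set.Iic 0))
  left_L2 : MemLp (fun x => v x - (ml : ℝ)) 2 (volume.restrict (Set.Iic 0))
  deriv_L1 : MemLp (deriv v) 1 volume
  deriv_L2 : MemLp (deriv v) 2 volume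

/-- The ambient space: functions `ξ` with `ξ - v ∈ L¹(ℝ)` and `‖ξ - v‖_{L¹(ℝ)} ≤ Cbar`. -/
def ambient (v : ℝ → ℝ) (Cbar : ℝ) : Set (ℝ → ℝ) :=
  {ξ | Integrable (fun x => ξ x - v x) volume ∧ ∫ x, |ξ x - v x| ≤ Cbar}

/-- Convergence in `L¹_loc(ℝ)`. -/
def TendstoL1loc (u : ℕ → ℝ → ℝ) (u₀ : ℝ → ℝ) : Prop :=
  ∀ K : Set ℝ, IsCompact K →
    Tendsto (fun n => ∫⁻ x in K, ENNReal.ofReal |u n x - u₀ x|) atTop (𝓝 0)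

/-- `ξ` is continuous and affine on each interval `[iρ, (i+1)ρ]`, `i ∈ ℤ`. -/
def IsPiecewiseAffine (ρ : ℝ) (ξ : ℝ → ℝ) : Prop :=
  Continuous ξ ∧ ∀ i : ℤ, ∃ a b : ℝ,
    ∀ x ∈ Set.Icc ((i : ℝ) * ρ) (((i : ℝ) + 1) * ρ), ξ x = a * x + b

open Classical in
/-- The energy `ε ∫ ξ'² + ε⁻¹ ∫ w(ξ)` (with values in `[0, ∞]`) if `ξ` is continuous and piecewise
affine on `(εδ)ℤ`, and `∞` otherwise. It is only considered for `ξ` in the ambient space. For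
piecewise affine `ξ`, `deriv ξ` is the derivative off the (Lebesgue-null) lattice. -/
noncomputable def energy (w : ℝ → ℝ) (ε δ : ℝ) (ξ : ℝ → ℝ) : ℝ≥0∞ :=
  if IsPiecewiseAffine (ε * δ) ξ then
    ENNReal.ofReal ε * (∫⁻ x, ENNReal.ofReal ((deriv ξ x) ^ 2)) +
      ENNReal.ofReal ε⁻¹ * (∫⁻ x, ENNReal.ofReal (w (ξ x)))
  else ∞

/-- The total variation on `ℝ` of a locally integrable function,
`Var(ξ, ℝ) = sup {∫ ξ φ' : φ ∈ C¹_c(ℝ), |φ| ≤ 1}`. -/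
noncomputable def totalVariation (ξ : ℝ → ℝ) : ℝ≥0∞ :=
  ⨆ φ : {φ : ℝ → ℝ // ContDiff ℝ 1 φ ∧ HasCompactSupport φ ∧ ∀ x, |φ x| ≤ 1},
    ENNReal.ofReal (∫ x, ξ x * deriv φ.1 x)

/-- `ξ` takes integer values almost everywhere and has finite total variation. -/
def IsIntegerBV (ξ : ℝ → ℝ) : Prop :=
  (∀ᵐ x, ∃ z : ℤ, ξ x = z) ∧ totalVariation ξ < ∞

open Classical in
/-- The limit energy: `pbar * Var(ξ, ℝ)` on integer-valued functions of bounded variation, and `∞`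
otherwise, where `pbar = p(1) = 2 ∫₀¹ √w`. -/
noncomputable def limitEnergy (w : ℝ → ℝ) (ξ : ℝ → ℝ) : ℝ≥0∞ :=
  if IsIntegerBV ξ then ENNReal.ofReal (primitive w 1) * totalVariation ξ else ∞

/-- (Sequential) Γ-convergence of `F n` to `F₀` on the set `X` with respect to the notion of
convergence `conv`: the liminf inequality and existence of recovery sequences. -/
def GammaConverges {α : Type*} (X : Set α) (conv : (ℕ → α) → α → Prop)
    (F : ℕ → α → ℝ≥0∞) (F₀ : α → ℝ≥0∞) : Prop :=
  ∀ x ∈ X,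
    (∀ u : ℕ → α, (∀ n, u n ∈ X) → conv u x → F₀ x ≤ liminf (fun n => F n (u n)) atTop) ∧
    (∃ u : ℕ → α, (∀ n, u n ∈ X) ∧ conv u x ∧ limsup (fun n => F n (u n)) atTop ≤ F₀ x)

end DomainWall

namespace DomainWall

/-! This is the Modica-Mortola argument. Let p be the primitive of 2√w vanishing at 0. Young's
inequality gives |(p∘ξ)'| = 2√w(ξ)|ξ'| ≤ ε ξ'² + ε⁻¹ w(ξ), so the energy controls the variation of
p∘ξ. As w is 1-periodic and vanishes exactly on ℤ, p is a Lipschitz, increasing homeomorphism of ℝ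
with p(z) = p(1) z for integers z.

Lower bound: bounded energy forces w(ξ_n) → 0 in L¹, so the limit ξ₀ is integer-valued. Then
p(1)∫ξ₀φ' = ∫p(ξ₀)φ' is the limit of ∫p(ξ_n)φ', each at most the energy
(`isIntegerBV_and_le_of_tendsto`).

Compactness: the functions p∘ξ_n have uniformly bounded variation, and the L¹ constraint anchors
them at a point of [0,1]. Helly's theorem gives almost everywhere convergence, which p⁻¹ carries
back to ξ_n (`exists_subseq_tendstoL1loc`).

Upper bound: an integer-valued function of finite variation is a step function with finitely many
jumps d, the sum of |d| being at most the variation (`IsIntegerBV.exists_integerStep`). Each jump is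
replaced by a grid-affine profile whose nodes follow the Euler scheme for y' = √w(y) + τ, nearly the
equality case of Young's inequality (`exists_transition`). The bound on ‖ξ - v‖ leaves no room for
error, so the profile is placed on the side of the jump, or split across it, that keeps |u - v| ≤ |ξ
- v| almost everywhere (`exists_split`). Separated profiles superpose without interaction because w
is periodic, and a diagonal choice of the accuracy finishes the proof. -/

/-! ### The periodic potential and its primitive. -/

theorem uniformContinuous_of_periodic {f : ℝ → ℝ} (hf : Continuous f)
    (hp : Function.Periodic f 1) : UniformContinuous f := by
  rw [Metric.uniformContinuous_iff]
  intro e he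
  have hc := (isCompact_Icc (a := (-1 : ℝ)) (b := 2)).uniformContinuousOn_of_continuous
    hf.continuousOn
  obtain ⟨d, hd, H⟩ := Metric.uniformContinuousOn_iff.1 hc e he
  refine ⟨min d 1, by positivity, fun {x} {y} hxy => ?_⟩
  have hsub : ∀ z, f (z - ⌊x⌋) = f z := fun z => by
    have := hp.sub_int_mul_eq (x := z) ⌊x⌋
    rwa [mul_one] at this
  rw [← hsub x, ← hsub y]
  have h1 := Int.floor_le x
  have h2 := Int.lt_floor_add_one x
  rw [Real.dist_eq] at hxy
  have h3 := abs_lt.1 (hxy.trans_le (min_le_right _ _))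
  refine H _ ⟨by linarith, by linarith⟩ _ ⟨by linarith, by linarith⟩ ?_
  rw [Real.dist_eq, sub_sub_sub_cancel_right]
  exact hxy.trans_le (min_le_left _ _)

/-- The properties of the potential that the analysis uses. -/
structure IsPeriodicWell (w : ℝ → ℝ) : Prop where
  continuous : Continuous w
  periodic : ∀ x, w (x + 1) = w x
  int_eq_zero : ∀ z : ℤ, w z = 0
  pos : ∀ x : ℝ, (∀ z : ℤ, x ≠ z) → 0 < w x

/-- Evenness makes the reflection j ↦ -2 - j negate the summands of w(1), whence w(1) = 0. Shifting
the index by one then gives w(x + 1) = w(x) + w(1). -/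
theorem IsAdmissibleInteraction.isPeriodicWell {h : ℝ → ℝ} {σ : ℝ}
    (hh : IsAdmissibleInteraction h σ) : IsPeriodicWell (potential h σ) := by
  have h1 : potential h σ 1 = 0 := by
    have hs := hh.summable 1
    set F : ℤ → ℝ := fun j => h (((j : ℝ) + 1 / 2 + 1) / σ) - h (((j : ℝ) + 1 / 2) / σ) with hF
    have key : ∀ j, F (Equiv.subLeft (-2 : ℤ) j) = - F j := by
      intro j
      have e1 : h ((((-2 - j : ℤ) : ℝ) + 1 / 2 + 1) / σ) = h (((j : ℝ) + 1 / 2) / σ) := by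
        rw [← hh.even]; congr 1; push_cast; ring
      have e2 : h ((((-2 - j : ℤ) : ℝ) + 1 / 2) / σ) = h (((j : ℝ) + 1 / 2 + 1) / σ) := by
        rw [← hh.even]; congr 1; push_cast; ring
      simp only [hF, Equiv.subLeft_apply, e1, e2]; ring
    have e : ∑' j, F j = - ∑' j, F j := by
      rw [← tsum_neg, ← (Equiv.subLeft (-2 : ℤ)).tsum_eq F]
      exact tsum_congr key
    have : potential h σ 1 = ∑' j, F j := rfl
    linarith
  have hper : ∀ x, potential h σ (x + 1) = potential h σ x := by
    intro x
    have hs := hh.summable x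
    have hs1 := hh.summable 1
    have hs' := ((Equiv.addRight (1 : ℤ)).summable_iff (f := fun j : ℤ =>
      h (((j : ℝ) + 1 / 2 + x) / σ) - h (((j : ℝ) + 1 / 2) / σ))).2 hs
    have e := (Equiv.addRight (1 : ℤ)).tsum_eq (fun j : ℤ =>
      h (((j : ℝ) + 1 / 2 + x) / σ) - h (((j : ℝ) + 1 / 2) / σ))
    calc potential h σ (x + 1) = ∑' j : ℤ, ((h ((((j + 1 : ℤ) : ℝ) + 1 / 2 + x) / σ)
          - h ((((j + 1 : ℤ) : ℝ) + 1 / 2) / σ)) +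
          (h (((j : ℝ) + 1 / 2 + 1) / σ) - h (((j : ℝ) + 1 / 2) / σ))) := by
            refine tsum_congr fun j => ?_
            have a1 : (((j + 1 : ℤ) : ℝ) + 1 / 2 + x) / σ = ((j : ℝ) + 1 / 2 + (x + 1)) / σ := by
              push_cast; ring
            have a2 : (((j + 1 : ℤ) : ℝ) + 1 / 2) / σ = ((j : ℝ) + 1 / 2 + 1) / σ := by
              push_cast; ring
            rw [a1, a2]; ring
      _ = potential h σ x + potential h σ 1 := by
            exact (Summable.tsum_add hs' hs1).trans (congrArg₂ _ e rfl)
      _ = potential h σ x := by rw [h1, add_zero]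
  refine ⟨hh.contDiff.continuous, hper, fun z => ?_, hh.pos⟩
  have h0 : potential h σ 0 = 0 := by simp [potential]
  have := (Function.Periodic.int_mul (f := potential h σ) (c := 1) hper z) 0
  simpa [h0] using this

namespace IsPeriodicWell

variable {w : ℝ → ℝ}

theorem nonneg (hw : IsPeriodicWell w) (x : ℝ) : 0 ≤ w x := by
  by_cases hx : ∃ z : ℤ, x = z
  · obtain ⟨z, rfl⟩ := hx
    rw [hw.int_eq_zero]
  · exact (hw.pos x (by simpa using hx)).le

theorem add_int (hw : IsPeriodicWell w) (x : ℝ) (z : ℤ) : w (x + z) = w x := by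
  have := (Function.Periodic.int_mul (f := w) (c := 1) hw.periodic z) x
  simpa using this

theorem int_of_eq_zero (hw : IsPeriodicWell w) {x : ℝ} (hx : w x = 0) : ∃ z : ℤ, x = z := by
  by_contra h
  exact (hw.pos x (by simpa using h)).ne' hx

/-- Reduces decreasing transitions to increasing ones. -/
theorem comp_neg (hw : IsPeriodicWell w) : IsPeriodicWell (fun x => w (-x)) where
  continuous := hw.continuous.comp continuous_neg
  periodic x := by
    have := hw.periodic (-(x + 1))
    rw [← this]; congr 1; ring
  int_eq_zero z := by simpa using hw.int_eq_zero (-z)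
  pos x hx := hw.pos _ fun z hz => hx (-z) (by push_cast; linarith)

theorem exists_bound (hw : IsPeriodicWell w) : ∃ M : ℝ, 0 < M ∧ ∀ x, w x ≤ M := by
  obtain ⟨M, hM⟩ := (isCompact_Icc (a := (0 : ℝ)) (b := 1)).bddAbove_image hw.continuous.continuousOn
  refine ⟨max M 1, by positivity, fun x => ?_⟩
  have : w x = w (Int.fract x) := by
    conv_lhs => rw [← Int.fract_add_floor x]
    exact hw.add_int _ _
  rw [this]
  exact (hM ⟨_, ⟨Int.fract_nonneg _, (Int.fract_lt_one _).le⟩, rfl⟩).trans (le_max_left _ _)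

theorem continuous_sqrt (hw : IsPeriodicWell w) : Continuous fun x => √(w x) :=
  hw.continuous.sqrt

theorem sqrt_periodic (hw : IsPeriodicWell w) : Function.Periodic (fun x => √(w x)) 1 :=
  fun x => by simp only [hw.periodic]

theorem hasDerivAt_primitive (hw : IsPeriodicWell w) (x : ℝ) :
    HasDerivAt (primitive w) (2 * √(w x)) x :=
  (intervalIntegral.integral_hasDerivAt_right (hw.continuous_sqrt.intervalIntegrable _ _)
    hw.continuous_sqrt.aestronglyMeasurable.stronglyMeasurableAtFilter
    hw.continuous_sqrt.continuousAt).const_mul 2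

theorem continuous_primitive (hw : IsPeriodicWell w) : Continuous (primitive w) :=
  continuous_iff_continuousAt.2 fun x => (hw.hasDerivAt_primitive x).continuousAt

theorem primitive_sub (hw : IsPeriodicWell w) (a b : ℝ) :
    primitive w b - primitive w a = 2 * ∫ t in a..b, √(w t) := by
  have := intervalIntegral.integral_interval_sub_left
    (hw.continuous_sqrt.intervalIntegrable (μ := volume) 0 b)
    (hw.continuous_sqrt.intervalIntegrable 0 a)
  simp only [primitive]
  rw [← this]; ring

theorem integral_sqrt_pos (hw : IsPeriodicWell w) : 0 < ∫ t in (0 : ℝ)..1, √(w t) := by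
  refine intervalIntegral.intervalIntegral_pos_of_pos_on
    (hw.continuous_sqrt.intervalIntegrable _ _) (fun x hx => ?_) one_pos
  refine Real.sqrt_pos.2 (hw.pos x fun z hz => ?_)
  rw [hz] at hx
  have h1 : (0 : ℤ) < z := by exact_mod_cast hx.1
  have h2 : z < (1 : ℤ) := by exact_mod_cast hx.2
  omega

theorem primitive_one_pos (hw : IsPeriodicWell w) : 0 < primitive w 1 := by
  have := hw.integral_sqrt_pos
  simp only [primitive]; linarith

/-- Linearity on ℤ is what turns p∘ξ into a multiple of ξ for integer-valued ξ, and hence the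
variation of p∘ξ into the limit energy. -/
theorem primitive_int (hw : IsPeriodicWell w) (z : ℤ) : primitive w z = primitive w 1 * z := by
  have := hw.sqrt_periodic.intervalIntegral_add_zsmul_eq z 0
    (fun a b => hw.continuous_sqrt.intervalIntegrable a b)
  simp only [zsmul_eq_mul, mul_one, zero_add] at this
  simp only [primitive, this]; ring

/-- If p were constant between two points, w would vanish on the whole interval, which would then
consist of integers and be countable. -/
theorem strictMono_primitive (hw : IsPeriodicWell w) : StrictMono (primitive w) := by
  have hm : Monotone (primitive w) := monotone_of_hasDerivAt_nonneg
    (fun x => hw.hasDerivAt_primitive x) (fun x => by positivity)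
  intro a b hab
  refine lt_of_le_of_ne (hm hab.le) fun heq => ?_
  have hd : ∀ x ∈ Set.Ioo a b, √(w x) = 0 := by
    intro x hx
    have : (primitive w) =ᶠ[𝓝 x] fun _ => primitive w a := by
      filter_upwards [Ioo_mem_nhds hx.1 hx.2] with y hy
      exact le_antisymm (heq ▸ hm hy.2.le) (hm hy.1.le)
    have h2 := (hw.hasDerivAt_primitive x).unique ((hasDerivAt_const x _).congr_of_eventuallyEq this)
    linarith
  have hz : ∀ x ∈ Set.Ioo a b, x ∈ Set.range ((↑) : ℤ → ℝ) := by
    intro x hx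
    obtain ⟨z, hz⟩ := hw.int_of_eq_zero ((Real.sqrt_eq_zero (hw.nonneg x)).1 (hd x hx))
    exact ⟨z, hz.symm⟩
  have hcount : (Set.Ioo a b).Countable := (Set.countable_range _).mono hz
  exact (Cardinal.Real.Ioo_countable_iff.1 hcount).not_gt hab

theorem surjective_primitive (hw : IsPeriodicWell w) : Function.Surjective (primitive w) := by
  have hp := hw.integral_sqrt_pos
  have h1 := hw.sqrt_periodic.tendsto_atTop_intervalIntegral_of_pos hp one_pos
  have h2 := hw.sqrt_periodic.tendsto_atBot_intervalIntegral_of_pos hp one_pos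
  exact hw.continuous_primitive.surjective (h1.const_mul_atTop two_pos)
    (h2.const_mul_atBot two_pos)

theorem exists_primitive_lipschitz (hw : IsPeriodicWell w) :
    ∃ L : ℝ, 0 < L ∧ ∀ x y, |primitive w x - primitive w y| ≤ L * |x - y| := by
  obtain ⟨M, hM, hwM⟩ := hw.exists_bound
  refine ⟨2 * √M, by positivity, fun x y => ?_⟩
  have := Convex.norm_image_sub_le_of_norm_hasDerivWithin_le (C := 2 * √M)
    (fun z _ => (hw.hasDerivAt_primitive z).hasDerivWithinAt) (fun z _ => ?_) convex_univ
    (Set.mem_univ y) (Set.mem_univ x)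
  · simpa only [Real.norm_eq_abs] using this
  · rw [Real.norm_eq_abs, abs_of_nonneg (by positivity)]
    have := Real.sqrt_le_sqrt (hwM z)
    linarith

end IsPeriodicWell

/-! ### The Modica-Mortola inequality for piecewise affine functions. -/

/-- The energy density `ε ξ'² + ε⁻¹ w(ξ)`. -/
noncomputable def energyDensity (w : ℝ → ℝ) (ε : ℝ) (ξ : ℝ → ℝ) (x : ℝ) : ℝ≥0∞ :=
  ENNReal.ofReal (ε * (deriv ξ x) ^ 2) + ENNReal.ofReal (ε⁻¹ * w (ξ x))

theorem energy_eq_lintegral {w : ℝ → ℝ} {ε δ : ℝ} (hε : 0 < ε)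
    {ξ : ℝ → ℝ} (h : IsPiecewiseAffine (ε * δ) ξ) :
    energy w ε δ ξ = ∫⁻ x, energyDensity w ε ξ x := by
  rw [energy, if_pos h]
  simp only [energyDensity]
  rw [lintegral_add_left (by have := measurable_deriv ξ; fun_prop),
    ← lintegral_const_mul' _ _ ENNReal.ofReal_ne_top,
    ← lintegral_const_mul' _ _ ENNReal.ofReal_ne_top]
  simp only [ENNReal.ofReal_mul hε.le, ENNReal.ofReal_mul (inv_pos.2 hε).le]

theorem isPiecewiseAffine_of_energy_ne_top {w : ℝ → ℝ} {ε δ : ℝ} {ξ : ℝ → ℝ}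
    (h : energy w ε δ ξ ≠ ∞) : IsPiecewiseAffine (ε * δ) ξ := by
  by_contra hn
  exact h (by rw [energy, if_neg hn])

theorem exists_int_mem_Ico {ρ : ℝ} (hρ : 0 < ρ) (x : ℝ) :
    ∃ i : ℤ, (i : ℝ) * ρ ≤ x ∧ x < ((i : ℝ) + 1) * ρ :=
  ⟨⌊x / ρ⌋, (le_div_iff₀ hρ).1 (Int.floor_le _), (div_lt_iff₀ hρ).1 (Int.lt_floor_add_one _)⟩

theorem IsPiecewiseAffine.hasDerivAt {ρ : ℝ} (hρ : 0 < ρ) {ξ : ℝ → ℝ} (h : IsPiecewiseAffine ρ ξ)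
    {x : ℝ} (hx : x ∉ Set.range fun i : ℤ => (i : ℝ) * ρ) : HasDerivAt ξ (deriv ξ x) x := by
  obtain ⟨i, h1, h2⟩ := exists_int_mem_Ico hρ x
  obtain ⟨a, b, hab⟩ := h.2 i
  have h1' : (i : ℝ) * ρ < x := lt_of_le_of_ne h1 fun he => hx ⟨i, he⟩
  have : ξ =ᶠ[𝓝 x] fun y => a * y + b := by
    filter_upwards [Ioo_mem_nhds h1' h2] with y hy using hab y ⟨hy.1.le, hy.2.le⟩
  have hd : HasDerivAt (fun y => a * y + b) a x := by
    simpa using ((hasDerivAt_id x).const_mul a).add_const b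
  exact (hd.congr_of_eventuallyEq this).differentiableAt.hasDerivAt

theorem countable_lattice (ρ : ℝ) : (Set.range fun i : ℤ => (i : ℝ) * ρ).Countable :=
  Set.countable_range _

namespace IsPeriodicWell

variable {w : ℝ → ℝ}

/-- Young's inequality 2ab ≤ a² + b² with a = √ε |ξ'| and b = √(w(ξ)/ε). -/
theorem enorm_deriv_primitive_le (hw : IsPeriodicWell w) {ε : ℝ} (hε : 0 < ε) (ξ : ℝ → ℝ)
    (x : ℝ) : ‖2 * √(w (ξ x)) * deriv ξ x‖ₑ ≤ energyDensity w ε ξ x := by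
  rw [energyDensity, ← ENNReal.ofReal_add (by positivity)
    (mul_nonneg (inv_pos.2 hε).le (hw.nonneg _)), Real.enorm_eq_ofReal_abs]
  refine ENNReal.ofReal_le_ofReal ?_
  have hs := Real.sq_sqrt (hw.nonneg (ξ x))
  have he := Real.sq_sqrt hε.le
  have hep := Real.sqrt_pos.2 hε
  rw [abs_mul, abs_of_nonneg (by positivity : 0 ≤ 2 * √(w (ξ x)))]
  set s := √(w (ξ x))
  set e := √ε
  have h1 : ε * deriv ξ x ^ 2 + ε⁻¹ * w (ξ x) = (e * |deriv ξ x|) ^ 2 + (s / e) ^ 2 := by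
    rw [mul_pow, div_pow, sq_abs, hs, he]; ring
  have h2 : 2 * s * |deriv ξ x| = 2 * (e * |deriv ξ x|) * (s / e) := by
    field_simp
  rw [h1, h2]
  exact two_mul_le_add_sq _ _

variable {ε δ : ℝ} {ξ : ℝ → ℝ}

theorem integrable_deriv_primitive (hw : IsPeriodicWell w) (hε : 0 < ε)
    (hfin : energy w ε δ ξ ≠ ∞) : Integrable fun x => 2 * √(w (ξ x)) * deriv ξ x := by
  have hpa := isPiecewiseAffine_of_energy_ne_top hfin
  refine ⟨?_, ?_⟩
  · have h1 := (hw.continuous_sqrt.comp hpa.1).measurable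
    exact ((h1.const_mul 2).mul (measurable_deriv ξ)).aestronglyMeasurable
  · rw [energy_eq_lintegral hε hpa] at hfin
    exact (lintegral_mono fun x => hw.enorm_deriv_primitive_le hε ξ x).trans_lt hfin.lt_top

theorem primitive_comp_hasDerivAt (hw : IsPeriodicWell w) {ρ : ℝ} (hρ : 0 < ρ)
    (h : IsPiecewiseAffine ρ ξ) {x : ℝ} (hx : x ∉ Set.range fun i : ℤ => (i : ℝ) * ρ) :
    HasDerivAt (fun y => primitive w (ξ y)) (2 * √(w (ξ x)) * deriv ξ x) x :=
  (hw.hasDerivAt_primitive (ξ x)).comp x (h.hasDerivAt hρ hx)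

/-- The Modica-Mortola estimate on an interval. -/
theorem enorm_primitive_sub_le (hw : IsPeriodicWell w) (hε : 0 < ε) (hδ : 0 < δ)
    (hfin : energy w ε δ ξ ≠ ∞) {a b : ℝ} (hab : a ≤ b) :
    ‖primitive w (ξ b) - primitive w (ξ a)‖ₑ ≤ ∫⁻ x in Set.Ioc a b, energyDensity w ε ξ x := by
  have hpa := isPiecewiseAffine_of_energy_ne_top hfin
  have hi := hw.integrable_deriv_primitive hε hfin
  have h := integral_eq_of_hasDerivAt_off_countable (fun y => primitive w (ξ y))
    (fun x => 2 * √(w (ξ x)) * deriv ξ x) (countable_lattice (ε * δ))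
    (hw.continuous_primitive.comp hpa.1).continuousOn
    (fun x hx => hw.primitive_comp_hasDerivAt (mul_pos hε hδ) hpa hx.2)
    (hi.intervalIntegrable (a := a) (b := b))
  rw [← h, intervalIntegral.integral_of_le hab]
  exact (enorm_integral_le_lintegral_enorm _).trans
    (lintegral_mono fun x => hw.enorm_deriv_primitive_le hε ξ x)

/-- The Modica-Mortola estimate against a test function. -/
theorem ofReal_integral_primitive_mul_deriv_le (hw : IsPeriodicWell w) (hε : 0 < ε) (hδ : 0 < δ)
    (hfin : energy w ε δ ξ ≠ ∞) {φ : ℝ → ℝ} (hφ : ContDiff ℝ 1 φ) (hφc : HasCompactSupport φ)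
    (hφ1 : ∀ x, |φ x| ≤ 1) :
    ENNReal.ofReal (∫ x, primitive w (ξ x) * deriv φ x) ≤ energy w ε δ ξ := by
  have hpa := isPiecewiseAffine_of_energy_ne_top hfin
  have hi := hw.integrable_deriv_primitive hε hfin
  set g : ℝ → ℝ := fun x => 2 * √(w (ξ x)) * deriv ξ x with hg
  set G : ℝ → ℝ := fun y => primitive w (ξ y) with hG
  have hGc : Continuous G := hw.continuous_primitive.comp hpa.1
  have hφ'c : Continuous (deriv φ) := hφ.continuous_deriv le_rfl
  have i1 : Integrable fun x => G x * deriv φ x :=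
    (hGc.mul hφ'c).integrable_of_hasCompactSupport (hφc.deriv.mul_left)
  have i2 : Integrable fun x => g x * φ x :=
    hi.mul_bdd (c := 1) hφ.continuous.aestronglyMeasurable
      (ae_of_all _ fun x => by simpa using hφ1 x)
  obtain ⟨R, hR⟩ := hφc.isBounded.subset_ball 0
  rw [Real.ball_eq_Ioo] at hR
  have hzero : ∀ x, x ∉ Set.Ioo (0 - R) (0 + R) → φ x = 0 := fun x hx =>
    image_eq_zero_of_notMem_tsupport fun h => hx (hR h)
  have hzero' : ∀ x, x ∉ Set.Ioo (0 - R) (0 + R) → deriv φ x = 0 := fun x hx => by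
    by_contra h
    exact hx (hR (tsupport_deriv_subset (subset_tsupport _ h)))
  have h := integral_eq_of_hasDerivAt_off_countable (fun y => G y * φ y)
    (fun x => g x * φ x + G x * deriv φ x) (countable_lattice (ε * δ))
    (a := 0 - R) (b := 0 + R) (hGc.mul hφ.continuous).continuousOn
    (fun x hx => (hw.primitive_comp_hasDerivAt (mul_pos hε hδ) hpa hx.2).mul
      (hφ.differentiable one_ne_zero x).hasDerivAt)
    ((i2.add i1).intervalIntegrable)
  rw [intervalIntegral.integral_eq_integral_of_support_subset, integral_add i2 i1,
    hzero (0 - R) (by simp), hzero (0 + R) (by simp)] at h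
  -- Integration by parts: the boundary terms vanish since φ is zero at ±R.
  · have h2 : ∫ x, G x * deriv φ x = - ∫ x, g x * φ x := by simp at h; linarith
    rw [h2, energy_eq_lintegral hε hpa]
    calc ENNReal.ofReal (- ∫ x, g x * φ x) ≤ ‖∫ x, g x * φ x‖ₑ := by
          rw [Real.enorm_eq_ofReal_abs]; exact ENNReal.ofReal_le_ofReal (neg_le_abs _)
      _ ≤ ∫⁻ x, ‖g x * φ x‖ₑ := enorm_integral_le_lintegral_enorm _
      _ ≤ ∫⁻ x, energyDensity w ε ξ x := by
          refine lintegral_mono fun x => le_trans ?_ (hw.enorm_deriv_primitive_le hε ξ x)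
          rw [enorm_mul]
          refine mul_le_of_le_one_right' ?_
          rw [Real.enorm_eq_ofReal_abs]
          exact ENNReal.ofReal_le_one.2 (hφ1 x)
  · intro x hx
    by_contra hn
    have hn' : x ∉ Set.Ioo (0 - R) (0 + R) := fun h' => hn ⟨h'.1, h'.2.le⟩
    exact hx (by simp [hzero x hn', hzero' x hn'])

end IsPeriodicWell

/-! ### The lower bound. -/

theorem TendstoL1loc.comp {u : ℕ → ℝ → ℝ} {u₀ : ℝ → ℝ} (h : TendstoL1loc u u₀) {k : ℕ → ℕ}
    (hk : Tendsto k atTop atTop) : TendstoL1loc (fun n => u (k n)) u₀ :=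
  fun K hK => (h K hK).comp hk

theorem TendstoL1loc.exists_subseq_ae {u : ℕ → ℝ → ℝ} {u₀ : ℝ → ℝ} (h : TendstoL1loc u u₀)
    (hu : ∀ n, AEStronglyMeasurable (u n)) (hu₀ : AEStronglyMeasurable u₀) {K : Set ℝ}
    (hK : IsCompact K) : ∃ k : ℕ → ℕ, StrictMono k ∧
      ∀ᵐ x ∂(volume.restrict K), Tendsto (fun n => u (k n) x) atTop (𝓝 (u₀ x)) := by
  refine (tendstoInMeasure_of_tendsto_eLpNorm (p := 1) one_ne_zero (fun n => (hu n).restrict)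
    hu₀.restrict ?_).exists_seq_tendsto_ae
  simpa only [eLpNorm_one_eq_lintegral_enorm, Pi.sub_apply, Real.enorm_eq_ofReal_abs] using h K hK

theorem lintegral_potential_le {w : ℝ → ℝ} {ε δ : ℝ} (hε : 0 < ε) (ξ : ℝ → ℝ) :
    ∫⁻ x, ENNReal.ofReal (w (ξ x)) ≤ ENNReal.ofReal ε * energy w ε δ ξ := by
  by_cases hpa : IsPiecewiseAffine (ε * δ) ξ
  · rw [energy, if_pos hpa, mul_add, ← mul_assoc (ENNReal.ofReal ε) (ENNReal.ofReal ε⁻¹),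
      ← ENNReal.ofReal_mul hε.le, mul_inv_cancel₀ hε.ne', ENNReal.ofReal_one, one_mul]
    exact le_add_self
  · rw [energy, if_neg hpa, ENNReal.mul_top (by simpa using hε)]
    exact le_top

namespace IsPeriodicWell

variable {w : ℝ → ℝ}

/-- On each compact interval, Fatou's lemma along an almost everywhere convergent subsequence gives
∫ w(ξ₀) ≤ lim ε_n c = 0, and w vanishes only on ℤ. -/
theorem ae_int_of_tendsto (hw : IsPeriodicWell w) {ε δ : ℕ → ℝ} (hε : ∀ n, 0 < ε n)
    (hε0 : Tendsto ε atTop (𝓝 0)) {ξ : ℕ → ℝ → ℝ}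
    {ξ₀ : ℝ → ℝ} (hm : ∀ n, AEStronglyMeasurable (ξ n)) (hm₀ : AEStronglyMeasurable ξ₀)
    (h : TendstoL1loc ξ ξ₀) {c : ℝ≥0∞} (hc : c ≠ ∞)
    (hE : ∀ n, energy w (ε n) (δ n) (ξ n) ≤ c) : ∀ᵐ x, ∃ z : ℤ, ξ₀ x = z := by
  have hK : ∀ k : ℕ, ∀ᵐ x, x ∈ Set.Icc (-k : ℝ) k → ∃ z : ℤ, ξ₀ x = z := by
    intro k
    rw [← ae_restrict_iff' measurableSet_Icc]
    obtain ⟨s, hs, hae⟩ := h.exists_subseq_ae hm hm₀ (isCompact_Icc (a := (-k : ℝ)) (b := k))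
    set μ := volume.restrict (Set.Icc (-k : ℝ) k)
    have hmeas : ∀ {f : ℝ → ℝ}, AEStronglyMeasurable f →
        AEMeasurable (fun x => ENNReal.ofReal (w (f x))) μ := fun hf =>
      (ENNReal.measurable_ofReal.comp hw.continuous.measurable).comp_aemeasurable
        hf.restrict.aemeasurable
    have hlim : Tendsto (fun n => ENNReal.ofReal (ε (s n)) * c) atTop (𝓝 0) := by
      have := ENNReal.tendsto_ofReal (hε0.comp hs.tendsto_atTop)
      simpa using ENNReal.Tendsto.mul_const this (Or.inr hc)
    have h0 : ∫⁻ x, ENNReal.ofReal (w (ξ₀ x)) ∂μ = 0 := by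
      refine le_antisymm ?_ zero_le
      calc ∫⁻ x, ENNReal.ofReal (w (ξ₀ x)) ∂μ
          = ∫⁻ x, liminf (fun n => ENNReal.ofReal (w (ξ (s n) x))) atTop ∂μ := by
            refine lintegral_congr_ae ?_
            filter_upwards [hae] with x hx
            exact (((ENNReal.continuous_ofReal.comp hw.continuous).tendsto _).comp hx).liminf_eq.symm
        _ ≤ liminf (fun n => ∫⁻ x, ENNReal.ofReal (w (ξ (s n) x)) ∂μ) atTop :=
            lintegral_liminf_le' fun n => hmeas (hm _)
        _ ≤ liminf (fun n => ENNReal.ofReal (ε (s n)) * c) atTop := by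
            refine liminf_le_liminf (Eventually.of_forall fun n => ?_)
            refine (setLIntegral_le_lintegral _ _).trans ?_
            exact (lintegral_potential_le (hε _) _).trans (by gcongr; exact hE _)
        _ = 0 := hlim.liminf_eq
    rw [lintegral_eq_zero_iff' (hmeas hm₀)] at h0
    filter_upwards [h0] with x hx
    exact hw.int_of_eq_zero (le_antisymm (ENNReal.ofReal_eq_zero.1 hx) (hw.nonneg _))
  filter_upwards [ae_all_iff.2 hK] with x hx
  obtain ⟨k, hk⟩ := exists_nat_ge |x|
  exact hx k (abs_le.1 hk)

/-- The Lipschitz bound on p lets p∘ξ inherit convergence in L¹_loc from ξ. -/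
theorem tendsto_integral_primitive (hw : IsPeriodicWell w) {ξ : ℕ → ℝ → ℝ}
    {ξ₀ : ℝ → ℝ} (hm : ∀ n, LocallyIntegrable (ξ n)) (hm₀ : LocallyIntegrable ξ₀)
    (h : TendstoL1loc ξ ξ₀) {ψ : ℝ → ℝ} (hψ : Continuous ψ) (hψc : HasCompactSupport ψ) :
    Tendsto (fun n => ∫ x, primitive w (ξ n x) * ψ x) atTop
      (𝓝 (∫ x, primitive w (ξ₀ x) * ψ x)) := by
  obtain ⟨L, hL, hLip⟩ := hw.exists_primitive_lipschitz
  obtain ⟨M, hM⟩ := hψc.exists_bound_of_continuous hψ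
  set K := tsupport ψ
  have hK : IsCompact K := hψc
  have hz : ∀ x, x ∉ K → ψ x = 0 := fun x hx => image_eq_zero_of_notMem_tsupport hx
  have hP : ∀ {f : ℝ → ℝ}, LocallyIntegrable f → Integrable fun x => primitive w (f x) * ψ x := by
    intro f hf
    have h1 : LocallyIntegrable fun x => primitive w (f x) := by
      refine (hf.smul L).mono
        (hw.continuous_primitive.comp_aestronglyMeasurable hf.aestronglyMeasurable)
        (ae_of_all _ fun x => ?_)
      have := hLip (f x) 0
      have h0 : primitive w 0 = 0 := by simp [primitive]
      simp only [h0, sub_zero] at this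
      simpa [abs_of_pos hL] using this
    simpa [mul_comm] using h1.integrable_smul_right_of_hasCompactSupport hψ hψc
  rw [tendsto_iff_edist_tendsto_0]
  have hlim : Tendsto (fun n => ENNReal.ofReal (L * M) *
      ∫⁻ x in K, ENNReal.ofReal |ξ n x - ξ₀ x|) atTop (𝓝 0) := by
    simpa using ENNReal.Tendsto.const_mul (h K hK) (Or.inr ENNReal.ofReal_ne_top)
  refine tendsto_of_tendsto_of_tendsto_of_le_of_le tendsto_const_nhds hlim
    (fun n => zero_le) fun n => ?_
  simp only
  rw [edist_eq_enorm_sub, ← integral_sub (hP (hm n)) (hP hm₀)]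
  have hsupp : ∫ x, (primitive w (ξ n x) * ψ x - primitive w (ξ₀ x) * ψ x) =
      ∫ x in K, (primitive w (ξ n x) * ψ x - primitive w (ξ₀ x) * ψ x) :=
    (setIntegral_eq_integral_of_forall_compl_eq_zero fun x hx => by simp [hz x hx]).symm
  rw [hsupp, ← lintegral_const_mul' _ _ ENNReal.ofReal_ne_top]
  refine (enorm_integral_le_lintegral_enorm _).trans (lintegral_mono fun x => ?_)
  rw [Real.enorm_eq_ofReal_abs, ← ENNReal.ofReal_mul' (abs_nonneg _)]
  refine ENNReal.ofReal_le_ofReal ?_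
  rw [← sub_mul, abs_mul]
  have h1 := hLip (ξ n x) (ξ₀ x)
  have h2 := hM x
  rw [Real.norm_eq_abs] at h2
  calc _ ≤ (L * |ξ n x - ξ₀ x|) * M := by gcongr
    _ = _ := by ring

/-- The lower bound and the integrality of limits of bounded-energy sequences. -/
theorem isIntegerBV_and_le_of_tendsto (hw : IsPeriodicWell w) {ε δ : ℕ → ℝ} (hε : ∀ n, 0 < ε n)
    (hδ : ∀ n, 0 < δ n) (hε0 : Tendsto ε atTop (𝓝 0)) {ξ : ℕ → ℝ → ℝ}
    {ξ₀ : ℝ → ℝ} (hm : ∀ n, LocallyIntegrable (ξ n)) (hm₀ : LocallyIntegrable ξ₀)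
    (h : TendstoL1loc ξ ξ₀) {c : ℝ≥0∞} (hc : c ≠ ∞)
    (hE : ∀ n, energy w (ε n) (δ n) (ξ n) ≤ c) :
    IsIntegerBV ξ₀ ∧ ENNReal.ofReal (primitive w 1) * totalVariation ξ₀ ≤ c := by
  have hint := hw.ae_int_of_tendsto hε hε0 (fun n => (hm n).aestronglyMeasurable)
    hm₀.aestronglyMeasurable h hc hE
  have hTV : ENNReal.ofReal (primitive w 1) * totalVariation ξ₀ ≤ c := by
    rw [totalVariation, ENNReal.mul_iSup]
    refine iSup_le fun φ => ?_
    obtain ⟨φ, hφ, hφc, hφ1⟩ := φ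
    simp only
    rw [← ENNReal.ofReal_mul hw.primitive_one_pos.le, ← integral_const_mul]
    have e : ∫ x, primitive w 1 * (ξ₀ x * deriv φ x) = ∫ x, primitive w (ξ₀ x) * deriv φ x := by
      refine integral_congr_ae ?_
      filter_upwards [hint] with x ⟨z, hz⟩
      simp only [hz, hw.primitive_int z, mul_assoc]
    rw [e]
    refine le_of_tendsto ((ENNReal.continuous_ofReal.tendsto _).comp
      (hw.tendsto_integral_primitive hm hm₀ h (hφ.continuous_deriv le_rfl) hφc.deriv))
      (Eventually.of_forall fun n => ?_)
    exact (hw.ofReal_integral_primitive_mul_deriv_le (hε n) (hδ n)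
      ((hE n).trans_lt hc.lt_top).ne hφ hφc hφ1).trans (hE n)
  refine ⟨⟨hint, ?_⟩, hTV⟩
  -- Since p(1) > 0, infinite variation would make the left side of `hTV` infinite.
  by_contra htop
  rw [not_lt, top_le_iff] at htop
  rw [htop, ENNReal.mul_top (by simpa using hw.primitive_one_pos)] at hTV
  exact hc (top_le_iff.1 hTV)

end IsPeriodicWell

theorem locallyIntegrable_of_mem_ambient {v ξ : ℝ → ℝ} {C : ℝ} (hv : Continuous v)
    (h : ξ ∈ ambient v C) : LocallyIntegrable ξ := by
  have := h.1.locallyIntegrable.add hv.locallyIntegrable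
  refine this.congr (ae_of_all _ fun x => ?_)
  simp

/-- The `liminf` inequality. -/
theorem limitEnergy_le_liminf {w : ℝ → ℝ} (hw : IsPeriodicWell w) {ε δ : ℕ → ℝ}
    (hε : ∀ n, 0 < ε n) (hδ : ∀ n, 0 < δ n) (hε0 : Tendsto ε atTop (𝓝 0)) {ξ : ℕ → ℝ → ℝ}
    {ξ₀ : ℝ → ℝ} (hm : ∀ n, LocallyIntegrable (ξ n)) (hm₀ : LocallyIntegrable ξ₀)
    (h : TendstoL1loc ξ ξ₀) :
    limitEnergy w ξ₀ ≤ liminf (fun n => energy w (ε n) (δ n) (ξ n)) atTop := by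
  refine le_of_forall_gt fun c hc => ?_
  obtain ⟨c', hc', hcc⟩ := exists_between hc
  -- Along a subsequence every energy is below c', which supplies the uniform bound needed for the
  -- integrality of the limit.
  obtain ⟨k, hk, hkE⟩ := extraction_of_frequently_atTop (frequently_lt_of_liminf_lt (by isBoundedDefault) hc')
  have := hw.isIntegerBV_and_le_of_tendsto (fun n => hε (k n)) (fun n => hδ (k n))
    (hε0.comp hk.tendsto_atTop) (fun n => hm (k n)) hm₀ (h.comp hk.tendsto_atTop)
    (hcc.trans_le le_top).ne (fun n => (hkE n).le)
  rw [limitEnergy, if_pos this.1]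
  exact this.2.trans_lt hcc

/-! ### Compactness. -/

/-- Helly's selection theorem for monotone functions with values in a fixed interval. -/
theorem exists_subseq_tendsto_of_monotone {V : ℕ → ℝ → ℝ} {a b : ℝ} (hV : ∀ n, Monotone (V n))
    (hab : ∀ n x, V n x ∈ Set.Icc a b) :
    ∃ k : ℕ → ℕ, StrictMono k ∧ ∃ (S : Set ℝ) (f : ℝ → ℝ), S.Countable ∧
      ∀ x ∉ S, Tendsto (fun n => V (k n) x) atTop (𝓝 (f x)) := by
  obtain ⟨L, hL, k, hk, hlim⟩ := (isCompact_univ_pi (fun _ : ℚ => isCompact_Icc (a := a) (b := b))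
    ).tendsto_subseq (x := fun n (q : ℚ) => V n q) (fun n q _ => hab n q)
  have hlim' : ∀ q : ℚ, Tendsto (fun n => V (k n) q) atTop (𝓝 (L q)) := tendsto_pi_nhds.1 hlim
  have hLm : Monotone L := fun p q hpq => le_of_tendsto_of_tendsto' (hlim' p) (hlim' q)
    fun n => hV _ (by exact_mod_cast hpq)
  have hLab : ∀ q, L q ∈ Set.Icc a b := fun q => hL q trivial
  -- A monotone extension of the limit on ℚ; at its continuity points, nearby rationals squeeze V (k
  -- n) x.
  set f : ℝ → ℝ := fun x => sSup (L '' {q : ℚ | (q : ℝ) < x}) with hf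
  have hbdd : ∀ x : ℝ, BddAbove (L '' {q : ℚ | (q : ℝ) < x}) := fun x =>
    ⟨b, by rintro _ ⟨q, _, rfl⟩; exact (hLab q).2⟩
  have hne : ∀ x : ℝ, (L '' {q : ℚ | (q : ℝ) < x}).Nonempty := fun x => by
    obtain ⟨q, hq⟩ := exists_rat_lt x
    exact ⟨_, q, hq, rfl⟩
  have hle : ∀ (q : ℚ) (x : ℝ), (q : ℝ) < x → L q ≤ f x := fun q x hq =>
    le_csSup (hbdd x) ⟨q, hq, rfl⟩
  have hge : ∀ (q : ℚ) (x : ℝ), x ≤ q → f x ≤ L q := fun q x hq => by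
    refine csSup_le (hne x) ?_
    rintro _ ⟨p, hp, rfl⟩
    exact hLm (by exact_mod_cast (lt_of_lt_of_le hp hq).le)
  have hfm : Monotone f := fun x y hxy =>
    csSup_le_csSup (hbdd y) (hne x) (Set.image_mono fun q hq => lt_of_lt_of_le hq hxy)
  refine ⟨k, hk, {x | ¬ ContinuousAt f x}, f, hfm.countable_not_continuousAt, fun x hx => ?_⟩
  have hc : ContinuousAt f x := by simpa using hx
  refine tendsto_order.2 ⟨fun c hcx => ?_, fun c hcx => ?_⟩
  · obtain ⟨l, hl, hl'⟩ := exists_Ioc_subset_of_mem_nhds (hc.eventually_const_lt hcx) ⟨x - 1, by simp⟩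
    obtain ⟨q, hq1, hq2⟩ := exists_rat_btwn (show (l + x) / 2 < x by linarith)
    have h1 : c < f ((l + x) / 2) := hl' ⟨by linarith, by linarith⟩
    have h2 : c < L q := h1.trans_le (hge q _ hq1.le)
    filter_upwards [(hlim' q).eventually_const_lt h2] with n hn
    exact hn.trans_le (hV _ hq2.le)
  · obtain ⟨l, hl, hl'⟩ := exists_Ico_subset_of_mem_nhds (hc.eventually_lt_const hcx) ⟨x + 1, by simp⟩
    obtain ⟨q, hq1, hq2⟩ := exists_rat_btwn (show x < (l + x) / 2 by linarith)
    have h1 : f ((l + x) / 2) < c := hl' ⟨by linarith, by linarith⟩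
    have h2 : L q < c := (hle q _ hq2).trans_lt h1
    filter_upwards [(hlim' q).eventually_lt_const h2] with n hn
    exact (hV _ hq1.le).trans_lt hn

/-- Functions that are, up to subtracting uniformly bounded monotone functions, dominated in
variation by bounded monotone functions have almost everywhere convergent subsequences. -/
theorem exists_subseq_tendsto_of_variation {V G : ℕ → ℝ → ℝ} {a b B : ℝ}
    (hV : ∀ n x, V n x ∈ Set.Icc a b) (hG : ∀ n x, |G n x| ≤ B)
    (hGV : ∀ n x y, x ≤ y → |G n y - G n x| ≤ V n y - V n x) :
    ∃ k : ℕ → ℕ, StrictMono k ∧ ∃ f : ℝ → ℝ,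
      ∀ᵐ x, Tendsto (fun n => G (k n) x) atTop (𝓝 (f x)) := by
  have hVm : ∀ n, Monotone (V n) := fun n x y hxy => by
    have := (abs_nonneg _).trans (hGV n x y hxy); linarith
  -- Jordan decomposition: G = V - (V - G) is a difference of bounded monotone functions, and
  -- Helly's theorem is applied to each in turn.
  have hUm : ∀ n, Monotone fun x => V n x - G n x := fun n x y hxy => by
    have := (le_abs_self _).trans (hGV n x y hxy)
    simp only; linarith
  obtain ⟨k, hk, S, f, hS, hf⟩ := exists_subseq_tendsto_of_monotone hVm hV
  obtain ⟨k', hk', S', f', hS', hf'⟩ := exists_subseq_tendsto_of_monotone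
    (fun n => hUm (k n)) (a := a - B) (b := b + B) (fun n x => by
      have h1 := abs_le.1 (hG (k n) x)
      have h2 := hV (k n) x
      exact ⟨by linarith [h2.1], by linarith [h2.2]⟩)
  refine ⟨k ∘ k', hk.comp hk', fun x => f x - f' x, ?_⟩
  filter_upwards [hS.ae_notMem volume, hS'.ae_notMem volume] with x hx hx'
  have := ((hf x hx).comp hk'.tendsto_atTop).sub (hf' x hx')
  simpa using this

/-- Otherwise the L¹ norm over [0,1] alone would be at least C + 1. This anchor turns a variation
bound into a uniform bound. -/
theorem exists_mem_abs_le_of_mem_ambient {v ξ : ℝ → ℝ} {C : ℝ} (h : ξ ∈ ambient v C) :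
    ∃ x ∈ Set.Icc (0 : ℝ) 1, |ξ x - v x| ≤ C + 1 := by
  by_contra! hn
  have h1 : ∫ x in Set.Icc (0 : ℝ) 1, (C + 1) ≤ ∫ x in Set.Icc (0 : ℝ) 1, |ξ x - v x| :=
    setIntegral_mono_on (by simp) h.1.abs.integrableOn measurableSet_Icc
      fun x hx => (hn x hx).le
  have h2 : ∫ x in Set.Icc (0 : ℝ) 1, |ξ x - v x| ≤ ∫ x, |ξ x - v x| :=
    setIntegral_le_integral h.1.abs (ae_of_all _ fun x => abs_nonneg _)
  have h3 := h.2
  simp at h1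
  linarith

/-- Fatou's lemma keeps the same constant C. -/
theorem mem_ambient_of_tendsto_ae {v ξ₀ : ℝ → ℝ} {ξ : ℕ → ℝ → ℝ} {C : ℝ}
    (h : ∀ n, ξ n ∈ ambient v C)
    (hlim : ∀ᵐ x, Tendsto (fun n => ξ n x) atTop (𝓝 (ξ₀ x))) : ξ₀ ∈ ambient v C := by
  have hC : 0 ≤ C := (integral_nonneg fun x => abs_nonneg _).trans (h 0).2
  have hlim' : ∀ᵐ x, Tendsto (fun n => ξ n x - v x) atTop (𝓝 (ξ₀ x - v x)) := by
    filter_upwards [hlim] with x hx using hx.sub_const _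
  have hm : AEStronglyMeasurable (fun x => ξ₀ x - v x) :=
    aestronglyMeasurable_of_tendsto_ae atTop (fun n => (h n).1.aestronglyMeasurable) hlim'
  have hbound : ∫⁻ x, ‖ξ₀ x - v x‖ₑ ≤ ENNReal.ofReal C := by
    calc ∫⁻ x, ‖ξ₀ x - v x‖ₑ = ∫⁻ x, liminf (fun n => ‖ξ n x - v x‖ₑ) atTop := by
          refine lintegral_congr_ae ?_
          filter_upwards [hlim'] with x hx using hx.enorm.liminf_eq.symm
      _ ≤ liminf (fun n => ∫⁻ x, ‖ξ n x - v x‖ₑ) atTop :=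
          lintegral_liminf_le' fun n => (h n).1.aestronglyMeasurable.enorm
      _ ≤ liminf (fun _ : ℕ => ENNReal.ofReal C) atTop := by
          refine liminf_le_liminf (Eventually.of_forall fun n => ?_)
          rw [← ofReal_integral_norm_eq_lintegral_enorm (h n).1]
          exact ENNReal.ofReal_le_ofReal (h n).2
      _ = ENNReal.ofReal C := by simp
  have hi : Integrable fun x => ξ₀ x - v x := ⟨hm, hbound.trans_lt ENNReal.ofReal_lt_top⟩
  refine ⟨hi, ?_⟩
  rw [← ofReal_integral_norm_eq_lintegral_enorm hi] at hbound
  exact (ENNReal.ofReal_le_ofReal_iff hC).1 hbound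

theorem tendstoL1loc_of_tendsto_ae {ξ₀ : ℝ → ℝ} {ξ : ℕ → ℝ → ℝ} {R : ℝ}
    (hm : ∀ n, AEStronglyMeasurable (ξ n)) (hR : ∀ n x, |ξ n x| ≤ R)
    (hlim : ∀ᵐ x, Tendsto (fun n => ξ n x) atTop (𝓝 (ξ₀ x))) : TendstoL1loc ξ ξ₀ := by
  intro K hK
  have hm₀ : AEStronglyMeasurable ξ₀ := aestronglyMeasurable_of_tendsto_ae atTop hm hlim
  have := tendsto_lintegral_of_dominated_convergence' (μ := volume.restrict K)
    (F := fun n x => ENNReal.ofReal |ξ n x - ξ₀ x|) (f := fun _ => 0)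
    (fun _ => ENNReal.ofReal (R + R))
    (fun n => ((continuous_abs.comp_aestronglyMeasurable
      ((hm n).sub hm₀)).aemeasurable.ennreal_ofReal).restrict)
    (fun n => ae_restrict_of_ae ?_) ?_ (ae_restrict_of_ae ?_)
  · simpa using this
  · filter_upwards [hlim] with x hx
    refine ENNReal.ofReal_le_ofReal ((abs_sub _ _).trans (add_le_add (hR n x) ?_))
    exact le_of_tendsto hx.abs (Eventually.of_forall fun n => hR n x)
  · rw [setLIntegral_const]
    exact ENNReal.mul_ne_top ENNReal.ofReal_ne_top hK.measure_lt_top.ne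
  · filter_upwards [hlim] with x hx
    have h1 : Tendsto (fun n => |ξ n x - ξ₀ x|) atTop (𝓝 0) := by
      simpa using (hx.sub_const (ξ₀ x)).abs
    simpa [Function.comp_def] using (ENNReal.continuous_ofReal.tendsto 0).comp h1

/-- Bounded-energy sequences in the ambient space are precompact. -/
theorem exists_subseq_tendstoL1loc {w : ℝ → ℝ} (hw : IsPeriodicWell w) {ε δ : ℕ → ℝ}
    (hε : ∀ n, 0 < ε n) (hδ : ∀ n, 0 < δ n) (hε0 : Tendsto ε atTop (𝓝 0)) {v : ℝ → ℝ}
    (hv : Continuous v) {Cbar : ℝ} {ξ : ℕ → ℝ → ℝ} (hξ : ∀ n, ξ n ∈ ambient v Cbar) {c : ℝ≥0∞}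
    (hc : c ≠ ∞) (hE : ∀ n, energy w (ε n) (δ n) (ξ n) ≤ c) :
    ∃ (k : ℕ → ℕ) (ξ₀ : ℝ → ℝ), StrictMono k ∧ ξ₀ ∈ ambient v Cbar ∧ IsIntegerBV ξ₀ ∧
      TendstoL1loc (fun n => ξ (k n)) ξ₀ := by
  have hfin : ∀ n, energy w (ε n) (δ n) (ξ n) ≠ ∞ := fun n => ((hE n).trans_lt hc.lt_top).ne
  have hcont : ∀ n, Continuous (ξ n) := fun n => (isPiecewiseAffine_of_energy_ne_top (hfin n)).1
  have hD : ∀ n, ∫⁻ x, energyDensity w (ε n) (ξ n) x ≤ c := fun n => by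
    rw [← energy_eq_lintegral (hε n) (isPiecewiseAffine_of_energy_ne_top (hfin n))]; exact hE n
  have hDs : ∀ n (s : Set ℝ), ∫⁻ x in s, energyDensity w (ε n) (ξ n) x ≤ c := fun n s =>
    (setLIntegral_le_lintegral _ _).trans (hD n)
  -- The energy stored in (-∞, x] is monotone in x, and its increments dominate those of p∘ξ_n.
  set V : ℕ → ℝ → ℝ := fun n x => (∫⁻ y in Set.Iic x, energyDensity w (ε n) (ξ n) y).toReal with hVdef
  set G : ℕ → ℝ → ℝ := fun n x => primitive w (ξ n x) with hGdef
  have hV : ∀ n x, V n x ∈ Set.Icc 0 c.toReal := fun n x =>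
    ⟨ENNReal.toReal_nonneg, ENNReal.toReal_mono hc (hDs n _)⟩
  have hGV : ∀ n x y, x ≤ y → |G n y - G n x| ≤ V n y - V n x := by
    intro n x y hxy
    have h1 := hw.enorm_primitive_sub_le (hε n) (hδ n) (hfin n) hxy
    have h2 : ∫⁻ z in Set.Iic y, energyDensity w (ε n) (ξ n) z =
        (∫⁻ z in Set.Iic x, energyDensity w (ε n) (ξ n) z) +
        ∫⁻ z in Set.Ioc x y, energyDensity w (ε n) (ξ n) z := by
      rw [← lintegral_union measurableSet_Ioc (Set.Iic_disjoint_Ioc le_rfl),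
        Set.Iic_union_Ioc_eq_Iic hxy]
    have hne : ∀ s : Set ℝ, ∫⁻ z in s, energyDensity w (ε n) (ξ n) z ≠ ∞ := fun s =>
      ((hDs n s).trans_lt hc.lt_top).ne
    simp only [hVdef, h2, ENNReal.toReal_add (hne _) (hne _), add_sub_cancel_left]
    have := ENNReal.toReal_mono (hne _) h1
    simpa using this
  obtain ⟨L, hL, hLip⟩ := hw.exists_primitive_lipschitz
  obtain ⟨M, hM⟩ := isCompact_Icc.exists_bound_of_continuousOn
    (hv.continuousOn (s := Set.Icc (0 : ℝ) 1))
  have hp0 : primitive w 0 = 0 := by simp [primitive]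
  -- The first term bounds p∘ξ_n at the anchor point in [0,1]; the second bounds its variation away
  -- from there.
  set B := L * (Cbar + 1 + M) + c.toReal with hB
  have hG : ∀ n x, |G n x| ≤ B := by
    intro n x
    obtain ⟨y, hy, hyC⟩ := exists_mem_abs_le_of_mem_ambient (hξ n)
    have h1 : |G n y| ≤ L * (Cbar + 1 + M) := by
      have h2 := hLip (ξ n y) 0
      simp only [hp0, sub_zero] at h2
      have h3 := hM y hy
      rw [Real.norm_eq_abs] at h3
      have h4 : |ξ n y| ≤ Cbar + 1 + M := by
        have := abs_add_le (ξ n y - v y) (v y)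
        rw [sub_add_cancel] at this
        linarith
      exact h2.trans (by gcongr)
    have h5 : |G n x - G n y| ≤ c.toReal := by
      rcases le_total y x with h | h
      · exact (hGV n y x h).trans (by linarith [(hV n x).2, (hV n y).1])
      · rw [abs_sub_comm]
        exact (hGV n x y h).trans (by linarith [(hV n y).2, (hV n x).1])
    have := abs_add_le (G n x - G n y) (G n y)
    rw [sub_add_cancel] at this
    linarith
  obtain ⟨k, hk, g, hg⟩ := exists_subseq_tendsto_of_variation hV hG hGV
  -- As an order isomorphism, p has a continuous inverse, which returns both the limit and the
  -- uniform bound from p∘ξ to ξ.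
  set P := (hw.strictMono_primitive.orderIsoOfSurjective _ hw.surjective_primitive) with hP
  have hPs : ∀ n x, P.symm (G n x) = ξ n x := fun n x => P.symm_apply_apply (ξ n x)
  have hlim : ∀ᵐ x, Tendsto (fun n => ξ (k n) x) atTop (𝓝 (P.symm (g x))) := by
    filter_upwards [hg] with x hx
    have := (P.symm.continuous.tendsto (g x)).comp hx
    refine this.congr fun n => hPs _ _
  have hR : ∀ n x, |ξ n x| ≤ max |P.symm (-B)| |P.symm B| := by
    intro n x
    have h := abs_le.1 (hG n x)
    have h1 := P.symm.monotone h.1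
    have h2 := P.symm.monotone h.2
    rw [hPs] at h1 h2
    exact abs_le_max_abs_abs h1 h2
  have hamb : (fun x => P.symm (g x)) ∈ ambient v Cbar :=
    mem_ambient_of_tendsto_ae (fun n => hξ (k n)) hlim
  have hL1 := tendstoL1loc_of_tendsto_ae (fun n => (hcont (k n)).aestronglyMeasurable)
    (fun n => hR (k n)) hlim
  exact ⟨k, _, hk, hamb, (hw.isIntegerBV_and_le_of_tendsto (fun n => hε (k n)) (fun n => hδ (k n))
    (hε0.comp hk.tendsto_atTop) (fun n => (hcont (k n)).locallyIntegrable)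
    (locallyIntegrable_of_mem_ambient hv hamb) hL1 hc (fun n => hE (k n))).1, hL1⟩

/-! ### From distributional to pointwise variation. -/

section Mollification

open scoped Convolution

/-- The smooth approximation `∫_{-R}^y b` of the Heaviside function built from a bump function. -/
noncomputable def bumpStep (b : ContDiffBump (0 : ℝ)) (y : ℝ) : ℝ :=
  ∫ t in (-b.rOut)..y, b.normed volume t

theorem hasDerivAt_bumpStep (b : ContDiffBump (0 : ℝ)) (y : ℝ) :
    HasDerivAt (bumpStep b) (b.normed volume y) y :=
  intervalIntegral.integral_hasDerivAt_right (b.continuous_normed.intervalIntegrable _ _)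
    b.continuous_normed.aestronglyMeasurable.stronglyMeasurableAtFilter
    b.continuous_normed.continuousAt

theorem monotone_bumpStep (b : ContDiffBump (0 : ℝ)) : Monotone (bumpStep b) :=
  monotone_of_hasDerivAt_nonneg (hasDerivAt_bumpStep b) fun x => b.nonneg_normed x

theorem normed_eq_zero (b : ContDiffBump (0 : ℝ)) {t : ℝ} (ht : b.rOut ≤ |t|) :
    b.normed volume t = 0 := by
  by_contra h
  have : t ∈ Function.support (b.normed volume) := h
  rw [b.support_normed_eq, Metric.mem_ball, Real.dist_eq, sub_zero] at this
  linarith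

theorem bumpStep_of_le (b : ContDiffBump (0 : ℝ)) {y : ℝ} (hy : y ≤ -b.rOut) :
    bumpStep b y = 0 := by
  rw [bumpStep, intervalIntegral.integral_symm, neg_eq_zero]
  refine intervalIntegral.integral_zero_ae (ae_of_all _ fun t ht => normed_eq_zero b ?_)
  rw [Set.uIoc_of_le hy] at ht
  rw [le_abs]; right; linarith [ht.2]

theorem bumpStep_of_ge (b : ContDiffBump (0 : ℝ)) {y : ℝ} (hy : b.rOut ≤ y) :
    bumpStep b y = 1 := by
  rw [← b.integral_normed (μ := volume), bumpStep]
  refine intervalIntegral.integral_eq_integral_of_support_subset fun t ht => ?_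
  rw [b.support_normed_eq, Metric.mem_ball, Real.dist_eq, sub_zero, abs_lt] at ht
  exact ⟨ht.1, by linarith [ht.2]⟩

theorem bumpStep_nonneg (b : ContDiffBump (0 : ℝ)) (y : ℝ) : 0 ≤ bumpStep b y := by
  rw [← bumpStep_of_le b (min_le_right y (-b.rOut))]
  exact monotone_bumpStep b (min_le_left _ _)

theorem bumpStep_le_one (b : ContDiffBump (0 : ℝ)) (y : ℝ) : bumpStep b y ≤ 1 := by
  rw [← bumpStep_of_ge b (le_max_right y b.rOut)]
  exact monotone_bumpStep b (le_max_left _ _)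

/-- Testing against a smoothed step function bounds signed increments of mollifications by the
total variation. -/
theorem ofReal_sum_convolution_le_totalVariation (b : ContDiffBump (0 : ℝ)) {ξ : ℝ → ℝ}
    (hξ : LocallyIntegrable ξ) {u : ℕ → ℝ} (hu : Monotone u) (m : ℕ) {s : ℕ → ℝ}
    (hs : ∀ i, |s i| ≤ 1) :
    ENNReal.ofReal (∑ i ∈ Finset.range m, s i *
      ((b.normed volume ⋆[ContinuousLinearMap.lsmul ℝ ℝ, volume] ξ) (u i) -
        (b.normed volume ⋆[ContinuousLinearMap.lsmul ℝ ℝ, volume] ξ) (u (i + 1)))) ≤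
      totalVariation ξ := by
  set k := b.normed volume with hk
  -- For increasing u the differences of steps are nonnegative and telescope to at most 1, so |φ| ≤
  -- 1. The derivative of φ is a sum of translated kernels, so testing ξ against it yields values of
  -- the mollification.
  set φ : ℝ → ℝ := fun y => ∑ i ∈ Finset.range m, s i *
    (bumpStep b (y - u i) - bumpStep b (y - u (i + 1))) with hφ
  have hder : ∀ y, HasDerivAt φ (∑ i ∈ Finset.range m, s i * (k (y - u i) - k (y - u (i + 1)))) y := by
    intro y
    refine HasDerivAt.fun_sum fun i _ => HasDerivAt.const_mul _ (HasDerivAt.sub ?_ ?_)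
    · exact (hasDerivAt_bumpStep b _).comp_sub_const _ _
    · exact (hasDerivAt_bumpStep b _).comp_sub_const _ _
  have hkc : Continuous k := b.continuous_normed
  have hdφ : deriv φ = fun y => ∑ i ∈ Finset.range m, s i * (k (y - u i) - k (y - u (i + 1))) :=
    funext fun y => (hder y).deriv
  have hC1 : ContDiff ℝ 1 φ := by
    refine contDiff_one_iff_deriv.2 ⟨fun y => (hder y).differentiableAt, ?_⟩
    rw [hdφ]; fun_prop
  have hbound : ∀ y, |φ y| ≤ 1 := by
    intro y
    calc |φ y| ≤ ∑ i ∈ Finset.range m, (bumpStep b (y - u i) - bumpStep b (y - u (i + 1))) := by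
          refine (Finset.abs_sum_le_sum_abs _ _).trans (Finset.sum_le_sum fun i _ => ?_)
          have : 0 ≤ bumpStep b (y - u i) - bumpStep b (y - u (i + 1)) :=
            sub_nonneg.2 (monotone_bumpStep b (by linarith [hu (Nat.le_succ i)]))
          rw [abs_mul, abs_of_nonneg this]
          exact mul_le_of_le_one_left this (hs i)
      _ = bumpStep b (y - u 0) - bumpStep b (y - u m) :=
          Finset.sum_range_sub' (fun i => bumpStep b (y - u i)) m
      _ ≤ 1 := by linarith [bumpStep_le_one b (y - u 0), bumpStep_nonneg b (y - u m)]
  have hcpt : HasCompactSupport φ := by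
    refine HasCompactSupport.intro (isCompact_Icc (a := u 0 - b.rOut) (b := u m + b.rOut))
      fun y hy => Finset.sum_eq_zero fun i hi => ?_
    have h0 := hu (Nat.zero_le i)
    have h0' := hu (Nat.zero_le (i + 1))
    have h1 := hu (Finset.mem_range.1 hi).le
    have h1' := hu (Nat.succ_le_of_lt (Finset.mem_range.1 hi))
    rw [Nat.succ_eq_add_one] at h1'
    rw [Set.mem_Icc, not_and_or, not_le, not_le] at hy
    rcases hy with hy | hy
    · rw [bumpStep_of_le b (by linarith), bumpStep_of_le b (by linarith), sub_self, mul_zero]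
    · rw [bumpStep_of_ge b (by linarith), bumpStep_of_ge b (by linarith), sub_self, mul_zero]
  have hint : ∀ x, Integrable fun y => ξ y * k (y - x) := by
    intro x
    have h1 : HasCompactSupport fun y => k (y - x) :=
      b.hasCompactSupport_normed.comp_homeomorph (Homeomorph.subRight x)
    have := hξ.integrable_smul_left_of_hasCompactSupport (hkc.comp (continuous_sub_right x)) h1
    simpa [mul_comm] using this
  have hconv : ∀ x, (k ⋆[ContinuousLinearMap.lsmul ℝ ℝ, volume] ξ) x = ∫ y, ξ y * k (y - x) := by
    intro x
    rw [convolution_eq_swap]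
    -- The kernel is even, so k(x - y) = k(y - x).
    refine integral_congr_ae (ae_of_all _ fun y => ?_)
    have := b.normed_neg (μ := volume) (x - y)
    rw [neg_sub] at this
    simp [hk, this, mul_comm]
  have hval : ∫ x, ξ x * deriv φ x = ∑ i ∈ Finset.range m, s i *
      ((k ⋆[ContinuousLinearMap.lsmul ℝ ℝ, volume] ξ) (u i) -
        (k ⋆[ContinuousLinearMap.lsmul ℝ ℝ, volume] ξ) (u (i + 1))) := by
    have e : ∀ x, ξ x * deriv φ x = ∑ i ∈ Finset.range m, s i *
        (ξ x * k (x - u i) - ξ x * k (x - u (i + 1))) := by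
      intro x
      rw [hdφ]
      simp only [Finset.mul_sum]
      exact Finset.sum_congr rfl fun i _ => by ring
    simp_rw [e]
    have hi : ∀ i ∈ Finset.range m, Integrable fun x =>
        s i * (ξ x * k (x - u i) - ξ x * k (x - u (i + 1))) :=
      fun i _ => ((hint _).sub (hint _)).const_mul _
    rw [integral_finsetSum _ hi]
    refine Finset.sum_congr rfl fun i _ => ?_
    rw [integral_const_mul, integral_sub (hint _) (hint _), hconv, hconv]
  rw [← hval, totalVariation]
  exact le_iSup (fun φ : {φ : ℝ → ℝ // ContDiff ℝ 1 φ ∧ HasCompactSupport φ ∧ ∀ x, |φ x| ≤ 1} =>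
    ENNReal.ofReal (∫ x, ξ x * deriv φ.1 x)) ⟨φ, hC1, hcpt, hbound⟩

/-- On a set of full measure, the pointwise variation is bounded by the distributional one. -/
theorem exists_eVariationOn_le_totalVariation {ξ : ℝ → ℝ} (hξ : LocallyIntegrable ξ) :
    ∃ D : Set ℝ, (∀ᵐ x, x ∈ D) ∧ eVariationOn ξ D ≤ totalVariation ξ := by
  -- The fixed ratio 2 of outer to inner radius is the hypothesis under which mollifications
  -- converge almost everywhere.
  let b : ℕ → ContDiffBump (0 : ℝ) := fun n =>
    ⟨1 / ((n : ℝ) + 1), 2 * (1 / ((n : ℝ) + 1)), by positivity, by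
      have : 0 < 1 / ((n : ℝ) + 1) := by positivity
      linarith⟩
  have hb : Tendsto (fun n => (b n).rOut) atTop (𝓝 0) := by
    simpa [b] using (tendsto_one_div_add_atTop_nhds_zero_nat (𝕜 := ℝ)).const_mul 2
  have hae := ContDiffBump.ae_convolution_tendsto_right_of_locallyIntegrable (μ := volume) (K := 2)
    hb (Eventually.of_forall fun n => le_rfl) hξ
  refine ⟨_, hae, iSup_le fun ⟨m, u, hu, huD⟩ => ?_⟩
  simp only
  -- These signs turn the signed increments into their absolute values.
  set s : ℕ → ℝ := fun i => (SignType.sign (ξ (u i) - ξ (u (i + 1))) : ℝ)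
  have hs : ∀ i, |s i| ≤ 1 := fun i => by
    simp only [s]
    rcases lt_trichotomy (ξ (u i) - ξ (u (i + 1))) 0 with h | h | h <;> simp [h]
  have e : ∑ i ∈ Finset.range m, edist (ξ (u (i + 1))) (ξ (u i)) =
      ENNReal.ofReal (∑ i ∈ Finset.range m, s i * (ξ (u i) - ξ (u (i + 1)))) := by
    rw [ENNReal.ofReal_sum_of_nonneg fun i _ => ?_]
    · refine Finset.sum_congr rfl fun i _ => ?_
      rw [edist_comm, edist_dist, Real.dist_eq, sign_mul_self]
    · rw [sign_mul_self]; exact abs_nonneg _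
  rw [e]
  have hlim : ∀ i, Tendsto (fun n => ((b n).normed volume
      ⋆[ContinuousLinearMap.lsmul ℝ ℝ, volume] ξ) (u i)) atTop (𝓝 (ξ (u i))) := huD
  refine le_of_tendsto ((ENNReal.continuous_ofReal.tendsto _).comp
    (tendsto_finsetSum _ fun i _ => ((hlim i).sub (hlim (i + 1))).const_mul (s i)))
    (Eventually.of_forall fun n => ?_)
  exact ofReal_sum_convolution_le_totalVariation (b n) hξ hu m hs

end Mollification

/-! ### Integer-valued functions of finite variation are step functions. -/

/-- The integer-valued step function with value `z₀` at `-∞` and jumps `d t` at `t ∈ T`. -/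
noncomputable def integerStep (z₀ : ℤ) (T : Finset ℝ) (d : ℝ → ℤ) (x : ℝ) : ℤ :=
  z₀ + ∑ t ∈ T with t < x, d t

/-- There are at most N + 1 levels; T collects the infima of the points where each level is reached.
If V x < V y, the infimum for the level V y lies in [x, y]. -/
theorem exists_finset_jumps {V : ℝ → ℕ} (hV : Monotone V) {N : ℕ} (hN : ∀ x, V x ≤ N) :
    ∃ T : Finset ℝ, ∀ x y, x ≤ y → (∀ t ∈ T, t ∉ Set.Icc x y) → V x = V y := by
  refine ⟨(Finset.range (N + 1)).image fun k => sInf {z | k ≤ V z}, fun x y hxy hT => ?_⟩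
  by_contra hne
  have hlt : V x < V y := lt_of_le_of_ne (hV hxy) hne
  have hlb : ∀ z ∈ {z | V y ≤ V z}, x ≤ z := fun z hz => by
    by_contra! hzx
    exact absurd (hV hzx.le) (by have : V y ≤ V z := hz; omega)
  refine hT (sInf {z | V y ≤ V z}) (Finset.mem_image.2 ⟨V y, ?_, rfl⟩) ⟨?_, ?_⟩
  · exact Finset.mem_range.2 (Nat.lt_succ_of_le (hN y))
  · exact le_csInf ⟨y, le_refl (V y)⟩ hlb
  · exact csInf_le ⟨x, hlb⟩ (le_refl (V y))

theorem exists_pos_gap (T : Finset ℝ) : ∃ g : ℝ, 0 < g ∧ ∀ s ∈ T, ∀ t ∈ T, s < t → g ≤ t - s := by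
  have : ∀ᶠ g in 𝓝[>] (0 : ℝ), ∀ s ∈ T, ∀ t ∈ T, s < t → g ≤ t - s := by
    refine (eventually_all_finset T).2 fun s _ => (eventually_all_finset T).2 fun t _ => ?_
    by_cases h : s < t
    · filter_upwards [Ioc_mem_nhdsGT (sub_pos.2 h)] with g hg _ using hg.2
    · exact Eventually.of_forall fun g hst => absurd hst h
  obtain ⟨g, hg, hg0⟩ := (this.and self_mem_nhdsWithin).exists
  exact ⟨g, hg0, hg⟩

theorem eVariationOn_inter_Iic_add_edist_le (f : ℝ → ℝ) (D : Set ℝ) {x y : ℝ} (hx : x ∈ D)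
    (hy : y ∈ D) (hxy : x ≤ y) :
    eVariationOn f (D ∩ Set.Iic x) + edist (f x) (f y) ≤ eVariationOn f (D ∩ Set.Iic y) := by
  calc eVariationOn f (D ∩ Set.Iic x) + edist (f x) (f y)
      ≤ eVariationOn f (D ∩ Set.Iic x) + eVariationOn f {x, y} := by
        gcongr
        exact eVariationOn.edist_le f (by simp) (by simp)
    _ ≤ eVariationOn f (D ∩ Set.Iic x ∪ {x, y}) := by
        refine eVariationOn.add_le_union f ?_
        rintro a ⟨_, ha⟩ b (rfl | rfl)
        · exact ha
        · exact le_trans ha hxy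
    _ ≤ eVariationOn f (D ∩ Set.Iic y) := by
        refine eVariationOn.mono f (Set.union_subset ?_ ?_)
        · exact Set.inter_subset_inter_right _ (Set.Iic_subset_Iic.2 hxy)
        · rintro b (rfl | rfl)
          · exact ⟨hx, hxy⟩
          · exact ⟨hy, Set.mem_Iic.2 le_rfl⟩

/-- The integer part of the variation of f up to x is bounded and monotone, so it changes at
finitely many points. Where it is constant the variation grows by less than 1, and an integer-valued
function cannot change. -/
theorem exists_finset_of_eVariationOn {f : ℝ → ℝ} {D : Set ℝ} (hint : ∀ x ∈ D, ∃ z : ℤ, f x = z)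
    (hfin : eVariationOn f D ≠ ∞) :
    ∃ T : Finset ℝ, ∀ x ∈ D, ∀ y ∈ D, x ≤ y → (∀ t ∈ T, t ∉ Set.Icc x y) → f x = f y := by
  set W : ℝ → ℝ≥0∞ := fun x => eVariationOn f (D ∩ Set.Iic x) with hW
  have hWle : ∀ x, W x ≤ eVariationOn f D := fun x => eVariationOn.mono f Set.inter_subset_left
  have hWfin : ∀ x, W x ≠ ∞ := fun x => ((hWle x).trans_lt hfin.lt_top).ne
  have hmono : Monotone fun x => ⌊(W x).toReal⌋₊ := fun x y hxy =>
    Nat.floor_le_floor (ENNReal.toReal_mono (hWfin y)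
      (eVariationOn.mono f (Set.inter_subset_inter_right _ (Set.Iic_subset_Iic.2 hxy))))
  obtain ⟨T, hT⟩ := exists_finset_jumps hmono (N := ⌊(eVariationOn f D).toReal⌋₊)
    fun x => Nat.floor_le_floor (ENNReal.toReal_mono hfin (hWle x))
  refine ⟨T, fun x hx y hy hxy hTxy => ?_⟩
  have h1 := hT x y hxy hTxy
  have h2 := eVariationOn_inter_Iic_add_edist_le f D hx hy hxy
  have h3 := ENNReal.toReal_mono (hWfin y) h2
  rw [ENNReal.toReal_add (hWfin x) (edist_ne_top _ _), edist_dist,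
    ENNReal.toReal_ofReal dist_nonneg, Real.dist_eq] at h3
  have h4 := Nat.floor_le (ENNReal.toReal_nonneg (a := W x))
  have h5 := Nat.lt_floor_add_one (W y).toReal
  rw [← h1] at h5
  obtain ⟨a, ha⟩ := hint x hx
  obtain ⟨b, hb⟩ := hint y hy
  have h6 : |f x - f y| < 1 := by
    change (W x).toReal + _ ≤ (W y).toReal at h3
    linarith
  rw [ha, hb] at h6 ⊢
  have h7 : |a - b| < 1 := by exact_mod_cast h6
  have := Int.abs_lt_one_iff.1 h7
  have : a = b := by omega
  rw [this]

/-- An integer-valued function of bounded variation on a dense set is a step function there. -/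
theorem exists_integerStep_of_eVariationOn {f : ℝ → ℝ} {D : Set ℝ} (hD : Dense D)
    (hint : ∀ x ∈ D, ∃ z : ℤ, f x = z) (hfin : eVariationOn f D ≠ ∞) :
    ∃ (z₀ : ℤ) (T : Finset ℝ) (d : ℝ → ℤ), (∀ x ∈ D, x ∉ T → f x = integerStep z₀ T d x) ∧
      ∑ t ∈ T, ENNReal.ofReal |(d t : ℝ)| ≤ eVariationOn f D := by
  obtain ⟨T, hT⟩ := exists_finset_of_eVariationOn hint hfin
  obtain ⟨g, hg, hgap⟩ := exists_pos_gap T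
  -- Sampling points of D within half the minimal gap of t on either side: the jump at t is read off
  -- there, and the intervals for different t do not overlap.
  have hl : ∀ t, ∃ l ∈ D, t - g / 2 < l ∧ l < t := fun t => by
    obtain ⟨l, hl1, hl2⟩ := hD.exists_between (show t - g / 2 < t by linarith)
    exact ⟨l, hl1, hl2⟩
  have hu : ∀ t, ∃ u ∈ D, t < u ∧ u < t + g / 2 := fun t => by
    obtain ⟨l, hl1, hl2⟩ := hD.exists_between (show t < t + g / 2 by linarith)
    exact ⟨l, hl1, hl2⟩
  choose l hlD hl1 hl2 using hl
  choose u huD hu1 hu2 using hu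
  obtain ⟨m, hm⟩ := T.bddBelow
  choose! n hn using hint
  set d : ℝ → ℤ := fun t => n (u t) - n (l t) with hd
  have hsep : ∀ s ∈ T, ∀ t ∈ T, s < t → u s ≤ l t := fun s hs t ht hst => by
    have := hgap s hs t ht hst
    linarith [hu2 s, hl1 t]
  -- Induction on the number of jump points left of x: removing the last one, t, replaces x by l t.
  -- The base value is taken at l m, left of all of T.
  have hval : ∀ k : ℕ, ∀ x ∈ D, x ∉ T → (T.filter (· < x)).card = k →
      n x = n (l m) + ∑ t ∈ T with t < x, d t := by
    intro k
    induction k with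
    | zero =>
      intro x hx hxT hk
      rw [Finset.card_eq_zero] at hk
      rw [hk, Finset.sum_empty, add_zero]
      have hlt : ∀ t ∈ T, x < t := fun t ht => by
        have h1 : ¬ t < x := fun h => by
          have : t ∈ T.filter (· < x) := Finset.mem_filter.2 ⟨ht, h⟩
          simp [hk] at this
        exact lt_of_le_of_ne (not_lt.1 h1) fun h => hxT (h ▸ ht)
      have hlm : ∀ t ∈ T, l m < t := fun t ht => (hl2 m).trans_le (hm ht)
      have : f x = f (l m) := by
        rcases le_total x (l m) with h | h
        · exact hT x hx _ (hlD m) h fun t ht hti => absurd hti.2 (not_le.2 (hlm t ht))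
        · exact (hT _ (hlD m) x hx h fun t ht hti => absurd hti.2 (not_le.2 (hlt t ht))).symm
      rw [hn x hx, hn _ (hlD m)] at this
      exact_mod_cast this
    | succ k ih =>
      intro x hx hxT hk
      have hne : (T.filter (· < x)).Nonempty := Finset.card_pos.1 (by omega)
      set t := (T.filter (· < x)).max' hne with ht
      have htm := (T.filter (· < x)).max'_mem hne
      rw [← ht, Finset.mem_filter] at htm
      have hmax : ∀ s ∈ T, s < x → s ≤ t := fun s hs hsx =>
        Finset.le_max' _ _ (Finset.mem_filter.2 ⟨hs, hsx⟩)
      have hnot : ∀ s ∈ T, t < s → x < s := fun s hs hts => by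
        by_contra! h
        exact absurd (hmax s hs (lt_of_le_of_ne h fun h => hxT (h ▸ hs))) (not_le.2 hts)
      have h1 : f x = f (u t) := by
        rcases le_total x (u t) with h | h
        · refine hT x hx _ (huD t) h fun s hs hsi => ?_
          have := hgap t htm.1 s hs (lt_of_lt_of_le htm.2 hsi.1)
          linarith [hsi.2, hu2 t]
        · exact (hT _ (huD t) x hx h fun s hs hsi => absurd hsi.2
            (not_le.2 (hnot s hs (lt_of_lt_of_le (hu1 t) hsi.1)))).symm
      have h2 : T.filter (· < x) = insert t (T.filter (· < l t)) := by
        ext s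
        simp only [Finset.mem_insert, Finset.mem_filter]
        constructor
        · rintro ⟨hs, hsx⟩
          rcases (hmax s hs hsx).eq_or_lt with h | h
          · exact Or.inl h
          · exact Or.inr ⟨hs, lt_of_lt_of_le (hu1 s) (hsep s hs t htm.1 h)⟩
        · rintro (rfl | ⟨hs, hsl⟩)
          · exact htm
          · exact ⟨hs, hsl.trans ((hl2 t).trans htm.2)⟩
      have h3 : t ∉ T.filter (· < l t) := fun h =>
        absurd (Finset.mem_filter.1 h).2 (not_lt.2 (hl2 t).le)
      have h4 : l t ∉ T := fun h => by
        have := hgap _ h t htm.1 (hl2 t)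
        linarith [hl1 t]
      have h5 := ih (l t) (hlD t) h4 (by
        rw [h2, Finset.card_insert_of_notMem h3] at hk; omega)
      rw [h2, Finset.sum_insert h3]
      rw [hn x hx, hn _ (huD t)] at h1
      have h6 : n x = n (u t) := by exact_mod_cast h1
      simp only [hd] at h5 ⊢
      rw [h6]; linarith
  have hsum : ∀ S : Finset ℝ, S ⊆ T → ∀ c, (∀ t ∈ S, u t ≤ c) →
      ∑ t ∈ S, ENNReal.ofReal |(d t : ℝ)| ≤ eVariationOn f (D ∩ Set.Iic c) := by
    intro S
    induction S using Finset.induction_on_max with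
    | empty => intros; simp
    | insert a S ha ih =>
      intro hS c hc
      have haS : a ∉ S := fun h => lt_irrefl _ (ha a h)
      have haT := hS (Finset.mem_insert_self a S)
      have hST : S ⊆ T := fun s hs => hS (Finset.mem_insert_of_mem hs)
      rw [Finset.sum_insert haS, add_comm]
      have h1 := ih hST (l a) fun t ht => hsep t (hST ht) a haT (ha t ht)
      have h2 : ENNReal.ofReal |(d a : ℝ)| = edist (f (l a)) (f (u a)) := by
        rw [edist_comm, edist_dist, Real.dist_eq, hn _ (huD a), hn _ (hlD a), hd]
        push_cast; rfl
      rw [h2]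
      refine (add_le_add_left h1 _).trans ((eVariationOn_inter_Iic_add_edist_le f D (hlD a) (huD a)
        ((hl2 a).trans (hu1 a)).le).trans (eVariationOn.mono f ?_))
      exact Set.inter_subset_inter_right _ (Set.Iic_subset_Iic.2 (hc a (Finset.mem_insert_self a S)))
  refine ⟨n (l m), T, d, fun x hx hxT => ?_, ?_⟩
  · rw [hn x hx, hval _ x hx hxT rfl, integerStep]
  · obtain ⟨c, hc⟩ := (T.image u).bddAbove
    exact (hsum T subset_rfl c fun t ht => hc (Finset.mem_coe.2 (Finset.mem_image_of_mem u ht))).trans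
      (eVariationOn.mono f Set.inter_subset_left)

/-- Structure of integer-valued functions of bounded variation on the line. -/
theorem IsIntegerBV.exists_integerStep {ξ : ℝ → ℝ} (h : IsIntegerBV ξ)
    (hξ : LocallyIntegrable ξ) :
    ∃ (z₀ : ℤ) (T : Finset ℝ) (d : ℝ → ℤ), (∀ᵐ x, ξ x = integerStep z₀ T d x) ∧
      ∑ t ∈ T, ENNReal.ofReal |(d t : ℝ)| ≤ totalVariation ξ := by
  obtain ⟨D, hD, hle⟩ := exists_eVariationOn_le_totalVariation hξ
  have hD' : ∀ᵐ x, x ∈ D ∩ {x | ∃ z : ℤ, ξ x = z} := hD.and h.1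
  have hle' := (eVariationOn.mono ξ (Set.inter_subset_left (s := D)
    (t := {x | ∃ z : ℤ, ξ x = z}))).trans hle
  obtain ⟨z₀, T, d, h1, h2⟩ := exists_integerStep_of_eVariationOn (Measure.dense_of_ae hD')
    (fun x hx => hx.2) (hle'.trans_lt h.2).ne
  refine ⟨z₀, T, d, ?_, h2.trans hle'⟩
  filter_upwards [hD', T.countable_toSet.ae_notMem volume] with x hx hxT using h1 x hx hxT

/-! ### Discrete almost optimal profiles. -/

/-- The explicit Euler scheme with step `δ` for `y' = r(y)`, stopped at `c`. -/
noncomputable def euler (r : ℝ → ℝ) (δ m c : ℝ) : ℕ → ℝ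
  | 0 => m
  | n + 1 => min c (euler r δ m c n + δ * r (euler r δ m c n))

theorem euler_succ (r : ℝ → ℝ) (δ m c : ℝ) (n : ℕ) :
    euler r δ m c (n + 1) = min c (euler r δ m c n + δ * r (euler r δ m c n)) := rfl

section Euler

variable {r : ℝ → ℝ} {δ m c : ℝ}

theorem euler_le (hmc : m ≤ c) (n : ℕ) : euler r δ m c n ≤ c := by
  cases n with
  | zero => exact hmc
  | succ n => exact min_le_left _ _

theorem monotone_euler (hmc : m ≤ c) (hδ : 0 < δ) (hr : ∀ x, 0 < r x) : Monotone (euler r δ m c) :=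
  monotone_nat_of_le_succ fun n => le_min (euler_le hmc n)
    (le_add_of_nonneg_right (mul_pos hδ (hr _)).le)

/-- Each step that is not cut off at c advances by at least δτ; the extra δ in the time bound pays
for the last step. -/
theorem exists_euler_eq (hmc : m ≤ c) (hδ : 0 < δ) {τ : ℝ} (hτ : 0 < τ) (hr : ∀ x, τ ≤ r x) :
    ∃ N : ℕ, (∀ i, N ≤ i → euler r δ m c i = c) ∧ (∀ i < N, euler r δ m c i < c) ∧
      N * δ ≤ (c - m) / τ + δ := by
  have hmono : Monotone (euler r δ m c) := monotone_euler hmc hδ fun x => hτ.trans_le (hr x)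
  have hgrow : ∀ n, euler r δ m c n < c → m + n * (δ * τ) ≤ euler r δ m c n := by
    intro n
    induction n with
    | zero => intro _; simp [euler]
    | succ n ih =>
      intro h
      have h1 := ih ((hmono (Nat.le_succ n)).trans_lt h)
      have h2 : euler r δ m c n + δ * r (euler r δ m c n) ≤ euler r δ m c (n + 1) := by
        rw [euler_succ] at h ⊢
        rcases min_choice c (euler r δ m c n + δ * r (euler r δ m c n)) with h' | h'
        · rw [h'] at h; exact absurd h (lt_irrefl _)
        · rw [h']
      have h3 := mul_le_mul_of_nonneg_left (hr (euler r δ m c n)) hδ.le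
      push_cast; linarith
  have hex : ∃ N, euler r δ m c N = c := by
    by_contra! hne
    obtain ⟨n, hn⟩ := exists_nat_gt ((c - m) / (δ * τ))
    have hlt := (euler_le (r := r) (δ := δ) hmc n).lt_of_ne (hne n)
    have h1 := hgrow n hlt
    rw [div_lt_iff₀ (mul_pos hδ hτ)] at hn
    linarith
  classical
  refine ⟨Nat.find hex, fun i hi => ?_, fun i hi =>
    (euler_le hmc i).lt_of_ne (Nat.find_min hex hi), ?_⟩
  · exact le_antisymm (euler_le hmc i) ((Nat.find_spec hex).symm.le.trans (hmono hi))
  · rcases hN : Nat.find hex with _ | n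
    · have := div_nonneg (sub_nonneg.2 hmc) hτ.le
      simp; linarith
    · have hlt := (euler_le (r := r) (δ := δ) hmc n).lt_of_ne (Nat.find_min hex (by omega))
      have h1 := hgrow n hlt
      have h2 : n * δ ≤ (c - m) / τ := by
        rw [le_div_iff₀ hτ]; linarith
      push_cast; linarith

end Euler

namespace IsPeriodicWell

variable {w : ℝ → ℝ}

theorem mul_le_primitive_sub (hw : IsPeriodicWell w) {a b q : ℝ} (hab : a ≤ b)
    (hq : ∀ z ∈ Set.Icc a b, q ≤ √(w z)) : 2 * (q * (b - a)) ≤ primitive w b - primitive w a := by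
  rw [hw.primitive_sub]
  have := intervalIntegral.integral_mono_on hab (intervalIntegrable_const (μ := volume) (c := q))
    (hw.continuous_sqrt.intervalIntegrable a b) hq
  rw [intervalIntegral.integral_const, smul_eq_mul] at this
  linarith

/-- Discrete transition of almost optimal energy from `m` up to a zero `c` of the potential. -/
theorem exists_discrete_transition_of_le (hw : IsPeriodicWell w) {m c : ℝ} (hmc : m ≤ c)
    (hc : w c = 0) {κ : ℝ} (hκ : 0 < κ) :
    ∃ Tm : ℝ, 0 < Tm ∧ ∃ δ₀ : ℝ, 0 < δ₀ ∧ ∀ δ : ℝ, 0 < δ → δ < δ₀ → ∃ (y : ℕ → ℝ) (N : ℕ) (M : ℕ → ℝ), y 0 = m ∧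
      (∀ i, N ≤ i → y i = c ∧ M i = 0) ∧ (∀ i, y i ∈ Set.uIcc m c) ∧ N * δ ≤ Tm ∧ (∀ i, 0 ≤ M i) ∧
      (∀ i, ∀ z ∈ Set.uIcc (y i) (y (i + 1)), w z ≤ M i) ∧
      ∑ i ∈ Finset.range N, ((y (i + 1) - y i) ^ 2 / δ + δ * M i) ≤
        |primitive w c - primitive w m| + κ := by
  have hcm : 0 ≤ c - m := sub_nonneg.2 hmc
  -- The speed √w + τ is positive even at zeros of w, so the scheme can leave them and reaches c in
  -- finite time. The value makes the total error 4τ(c - m) at most κ/2; the added 1 covers c = m.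
  set τ := κ / (8 * (c - m + 1)) with hτdef
  have hτ : 0 < τ := by positivity
  have hτκ : 4 * τ * (c - m) ≤ κ / 2 := by
    rw [hτdef]
    have : 4 * (κ / (8 * (c - m + 1))) * (c - m) = κ / 2 * ((c - m) / (c - m + 1)) := by
      field_simp; ring
    rw [this]
    exact mul_le_of_le_one_right (by positivity) ((div_le_one (by positivity)).2 (by linarith))
  obtain ⟨S, hS, hwS⟩ := hw.exists_bound
  obtain ⟨ω, hω, hmod⟩ := Metric.uniformContinuous_iff.1
    (uniformContinuous_of_periodic hw.continuous_sqrt hw.sqrt_periodic) τ hτ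
  set r : ℝ → ℝ := fun z => √(w z) + τ with hr
  set R := √S + τ with hR
  have hRpos : 0 < R := by positivity
  have hrR : ∀ z, r z ≤ R := fun z => by
    have := Real.sqrt_le_sqrt (hwS z)
    simp only [hr, hR]; linarith
  have hrτ : ∀ z, τ ≤ r z := fun z => by simp [hr]
  have hr0 : ∀ z, 0 < r z := fun z => hτ.trans_le (hrτ z)
  -- Below ω/R, one step moves less than ω, so √w varies by less than τ on a cell; below κ/(2R²),
  -- the last cell costs little.
  refine ⟨(c - m) / τ + min (ω / R) (κ / (2 * R ^ 2)), by positivity,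
    min (ω / R) (κ / (2 * R ^ 2)), by positivity, fun δ hδ hδ₀ => ?_⟩
  obtain ⟨N, hN1, hN2, hN3⟩ := exists_euler_eq (r := r) hmc hδ hτ hrτ
  set y := euler r δ m c with hy
  have hmono : Monotone y := monotone_euler hmc hδ hr0
  have hyc : ∀ i, y i ≤ c := fun i => euler_le hmc i
  have hym : ∀ i, m ≤ y i := fun i => hmono (Nat.zero_le i)
  have hδω : δ * R < ω := (lt_div_iff₀ hRpos).1 (hδ₀.trans_le (min_le_left _ _))
  have hδκ : δ * R ^ 2 < κ / 2 := by
    have := (lt_div_iff₀ (by positivity)).1 (hδ₀.trans_le (min_le_right (ω / R) (κ / (2 * R ^ 2))))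
    linarith
  have hstep : ∀ i, y (i + 1) - y i ≤ δ * r (y i) := fun i => by
    have : y (i + 1) ≤ y i + δ * r (y i) := min_le_right _ _
    linarith
  have hinc : ∀ i, 0 ≤ y (i + 1) - y i := fun i => sub_nonneg.2 (hmono (Nat.le_succ i))
  have hosc : ∀ i, ∀ z ∈ Set.Icc (y i) (y (i + 1)), √(w z) ≤ r (y i) ∧ r (y i) - 2 * τ ≤ √(w z) := by
    intro i z hz
    have h1 : dist z (y i) < ω := by
      rw [Real.dist_eq, abs_of_nonneg (by linarith [hz.1])]
      have := mul_le_mul_of_nonneg_left (hrR (y i)) hδ.le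
      linarith [hstep i, hz.2]
    have h2 := abs_lt.1 (hmod h1)
    simp only [hr]
    constructor <;> linarith [h2.1, h2.2]
  -- Both terms on the left are at most Δy · r, and 2Δy(r - 2τ) is at most the increment of p.
  have hcell : ∀ i, (y (i + 1) - y i) ^ 2 / δ + (y (i + 1) - y i) * r (y i) ≤
      primitive w (y (i + 1)) - primitive w (y i) + 4 * τ * (y (i + 1) - y i) := by
    intro i
    have h1 := hw.mul_le_primitive_sub (hmono (Nat.le_succ i)) fun z hz => (hosc i z hz).2
    have h2 : (y (i + 1) - y i) ^ 2 / δ ≤ (y (i + 1) - y i) * r (y i) := by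
      rw [div_le_iff₀ hδ, sq]
      have := mul_le_mul_of_nonneg_left (hstep i) (hinc i)
      linarith
    linarith
  have hsum : ∀ j, (∀ i < j, y (i + 1) < c) →
      ∑ i ∈ Finset.range j, ((y (i + 1) - y i) ^ 2 / δ + δ * r (y i) ^ 2) ≤
        primitive w (y j) - primitive w m + 4 * τ * (y j - m) := by
    intro j
    induction j with
    | zero => intro _; simp [hy, euler]
    | succ j ih =>
      intro hj
      rw [Finset.sum_range_succ]
      have h1 := ih fun i hi => hj i (by omega)
      have h2 := hj j (by omega)
      -- On a step not cut off at c, the potential term δr² equals Δy · r, the equality case of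
      -- Young's inequality.
      have h3 : y (j + 1) - y j = δ * r (y j) := by
        have h4 : y (j + 1) = min c (y j + δ * r (y j)) := rfl
        rw [h4] at h2 ⊢
        rcases min_choice c (y j + δ * r (y j)) with h' | h'
        · rw [h'] at h2; exact absurd h2 (lt_irrefl _)
        · rw [h']; ring
      have h5 := hcell j
      have h6 : δ * r (y j) ^ 2 = (y (j + 1) - y j) * r (y j) := by rw [h3]; ring
      rw [h6]
      linarith
  have hpm : primitive w m ≤ primitive w c := hw.strictMono_primitive.monotone hmc
  refine ⟨y, N, fun i => if i < N then r (y i) ^ 2 else 0, rfl, fun i hi => ⟨hN1 i hi, ?_⟩,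
    fun i => ?_, hN3.trans (by linarith), fun i => ?_, fun i z hz => ?_, ?_⟩
  · exact if_neg (not_lt.2 hi)
  · rw [Set.uIcc_of_le hmc]; exact ⟨hym i, hyc i⟩
  · simp only; split_ifs <;> positivity
  · simp only
    split_ifs with hi
    · rw [Set.uIcc_of_le (hmono (Nat.le_succ i))] at hz
      rw [← Real.sq_sqrt (hw.nonneg z)]
      exact pow_le_pow_left₀ (Real.sqrt_nonneg _) (hosc i z hz).1 2
    · rw [hN1 i (not_lt.1 hi), hN1 (i + 1) (by omega), Set.uIcc_self] at hz
      rw [hz, hc]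
  · have e : ∑ i ∈ Finset.range N, ((y (i + 1) - y i) ^ 2 / δ +
        δ * (if i < N then r (y i) ^ 2 else 0)) =
        ∑ i ∈ Finset.range N, ((y (i + 1) - y i) ^ 2 / δ + δ * r (y i) ^ 2) :=
      Finset.sum_congr rfl fun i hi => by rw [if_pos (Finset.mem_range.1 hi)]
    rw [e, abs_of_nonneg (sub_nonneg.2 hpm)]
    rcases N with _ | n
    · simp; linarith
    -- The last step may be cut off at c, so its potential term is bounded separately by δR² < κ/2.
    · rw [Finset.sum_range_succ]
      have h1 := hsum n fun i hi => hN2 (i + 1) (by omega)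
      have h2 := hcell n
      have h3 : δ * r (y n) ^ 2 ≤ δ * R ^ 2 :=
        mul_le_mul_of_nonneg_left (pow_le_pow_left₀ (hr0 _).le (hrR _) 2) hδ.le
      have h4 := mul_nonneg (hinc n) (hr0 (y n)).le
      rw [hN1 (n + 1) le_rfl] at h2 h4 ⊢
      linarith

theorem primitive_comp_neg (w : ℝ → ℝ) (z : ℝ) :
    primitive (fun x => w (-x)) z = - primitive w (-z) := by
  simp only [primitive]
  rw [intervalIntegral.integral_comp_neg (fun x => √(w x)), neg_zero,
    intervalIntegral.integral_symm]
  ring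

/-- Discrete transition of almost optimal energy from `m` to a zero `c` of the potential. -/
theorem exists_discrete_transition (hw : IsPeriodicWell w) (m : ℝ) {c : ℝ}
    (hc : w c = 0) {κ : ℝ} (hκ : 0 < κ) :
    ∃ Tm : ℝ, 0 < Tm ∧ ∃ δ₀ : ℝ, 0 < δ₀ ∧ ∀ δ : ℝ, 0 < δ → δ < δ₀ → ∃ (y : ℕ → ℝ) (N : ℕ) (M : ℕ → ℝ), y 0 = m ∧
      (∀ i, N ≤ i → y i = c ∧ M i = 0) ∧ (∀ i, y i ∈ Set.uIcc m c) ∧ N * δ ≤ Tm ∧ (∀ i, 0 ≤ M i) ∧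
      (∀ i, ∀ z ∈ Set.uIcc (y i) (y (i + 1)), w z ≤ M i) ∧
      ∑ i ∈ Finset.range N, ((y (i + 1) - y i) ^ 2 / δ + δ * M i) ≤
        |primitive w c - primitive w m| + κ := by
  rcases le_total m c with h | h
  · exact hw.exists_discrete_transition_of_le h hc hκ
  · obtain ⟨Tm, hTm, δ₀, hδ₀, H⟩ := hw.comp_neg.exists_discrete_transition_of_le
      (neg_le_neg h) (by simpa using hc) hκ
    refine ⟨Tm, hTm, δ₀, hδ₀, fun δ hδ hδ' => ?_⟩
    obtain ⟨y, N, M, h0, h1, h2, h3, h4, h5, h6⟩ := H δ hδ hδ'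
    have hneg : ∀ {a b z : ℝ}, z ∈ Set.uIcc (-a) (-b) → -z ∈ Set.uIcc a b := by
      intro a b z hz
      rw [Set.mem_uIcc] at hz ⊢
      rcases hz with hz | hz
      · right; constructor <;> linarith [hz.1, hz.2]
      · left; constructor <;> linarith [hz.1, hz.2]
    refine ⟨fun i => - y i, N, M, by simp [h0], fun i hi => ⟨by simp [(h1 i hi).1], (h1 i hi).2⟩,
      fun i => hneg (h2 i), h3, h4, fun i z hz => ?_, ?_⟩
    · have := h5 i (-z) (by
        have := hneg (a := y i) (b := y (i + 1)) hz
        exact this)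
      simpa using this
    · simp only [primitive_comp_neg, neg_neg] at h6
      have e : |(-primitive w c) - (-primitive w m)| = |primitive w c - primitive w m| := by
        rw [← abs_neg]; congr 1; ring
      rw [e] at h6
      refine le_trans (le_of_eq (Finset.sum_congr rfl fun i _ => ?_)) h6
      ring

end IsPeriodicWell

/-! ### Interpolation on the grid and transitions across a jump. -/

/-- The continuous function that is affine on each `[iρ, (i+1)ρ]` and equals `Y i` at `iρ`. -/
noncomputable def interp (Y : ℤ → ℝ) (ρ x : ℝ) : ℝ :=
  Y ⌊x / ρ⌋ + (x / ρ - ⌊x / ρ⌋) * (Y (⌊x / ρ⌋ + 1) - Y ⌊x / ρ⌋)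

section Interp

variable {Y : ℤ → ℝ} {ρ : ℝ}

theorem interp_of_mem_Icc (hρ : 0 < ρ) {i : ℤ} {x : ℝ}
    (hx : x ∈ Set.Icc ((i : ℝ) * ρ) (((i : ℝ) + 1) * ρ)) :
    interp Y ρ x = Y i + (x / ρ - i) * (Y (i + 1) - Y i) := by
  rcases hx.2.eq_or_lt with h | h
  · have : x / ρ = ((i + 1 : ℤ) : ℝ) := by rw [h]; push_cast; field_simp
    rw [interp, this, Int.floor_intCast]
    push_cast; ring
  · have : ⌊x / ρ⌋ = i :=
      Int.floor_eq_iff.2 ⟨(le_div_iff₀ hρ).2 hx.1, (div_lt_iff₀ hρ).2 h⟩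
    rw [interp, this]

theorem continuous_interp (hρ : 0 < ρ) : Continuous (interp Y ρ) := by
  refine continuous_iff_continuousAt.2 fun x => ?_
  set i := ⌊x / ρ⌋ with hi
  have h1 : (i : ℝ) * ρ ≤ x := (le_div_iff₀ hρ).1 (Int.floor_le _)
  have h2 : x < ((i : ℝ) + 1) * ρ := (div_lt_iff₀ hρ).1 (Int.lt_floor_add_one _)
  have hc : Continuous fun y : ℝ => if y ≤ (i : ℝ) * ρ then
      Y (i - 1) + (y / ρ - (i - 1 : ℤ)) * (Y (i - 1 + 1) - Y (i - 1)) else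
      Y i + (y / ρ - i) * (Y (i + 1) - Y i) := by
    refine Continuous.if_le (by fun_prop) (by fun_prop) continuous_id continuous_const
      fun y hy => ?_
    have : y / ρ = i := by rw [hy]; field_simp
    rw [this, sub_add_cancel]; push_cast; ring
  refine hc.continuousAt.congr ?_
  have h3 : ((i - 1 : ℤ) : ℝ) * ρ < x := by push_cast; linarith
  filter_upwards [Ioo_mem_nhds h3 h2] with y hy
  split_ifs with hyi
  · refine (interp_of_mem_Icc hρ ⟨hy.1.le, ?_⟩).symm
    push_cast; linarith
  · exact (interp_of_mem_Icc hρ ⟨(not_le.1 hyi).le, hy.2.le⟩).symm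

theorem isPiecewiseAffine_interp (hρ : 0 < ρ) : IsPiecewiseAffine ρ (interp Y ρ) := by
  refine ⟨continuous_interp hρ, fun i => ⟨(Y (i + 1) - Y i) / ρ,
    Y i - i * (Y (i + 1) - Y i), fun x hx => ?_⟩⟩
  rw [interp_of_mem_Icc hρ hx]; ring

theorem interp_mem_uIcc (hρ : 0 < ρ) {i : ℤ} {x : ℝ}
    (hx : x ∈ Set.Icc ((i : ℝ) * ρ) (((i : ℝ) + 1) * ρ)) :
    interp Y ρ x ∈ Set.uIcc (Y i) (Y (i + 1)) := by
  rw [interp_of_mem_Icc hρ hx, ← segment_eq_uIcc]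
  refine ⟨1 - (x / ρ - i), x / ρ - i, ?_, ?_, by ring, ?_⟩
  · have := (div_le_iff₀ hρ).2 hx.2; linarith
  · have := (le_div_iff₀ hρ).2 hx.1; linarith
  · simp only [smul_eq_mul]; ring

theorem deriv_interp (hρ : 0 < ρ) {i : ℤ} {x : ℝ}
    (hx : x ∈ Set.Ioo ((i : ℝ) * ρ) (((i : ℝ) + 1) * ρ)) :
    deriv (interp Y ρ) x = (Y (i + 1) - Y i) / ρ := by
  have : interp Y ρ =ᶠ[𝓝 x] fun y => Y i + (y / ρ - i) * (Y (i + 1) - Y i) := by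
    filter_upwards [Ioo_mem_nhds hx.1 hx.2] with y hy
    exact interp_of_mem_Icc hρ ⟨hy.1.le, hy.2.le⟩
  rw [this.deriv_eq]
  have h : HasDerivAt (fun y => Y i + (y / ρ - i) * (Y (i + 1) - Y i))
      (1 / ρ * (Y (i + 1) - Y i)) x :=
    ((((hasDerivAt_id x).div_const ρ).sub_const _).mul_const _).const_add _
  rw [h.deriv]; ring

/-- A cell has length εδ and slope ΔY/(εδ), so ε cancels: the bound is that of the rescaled problem
with step δ. -/
theorem energy_interp_le {w : ℝ → ℝ} {ε δ : ℝ} (hε : 0 < ε) (hδ : 0 < δ) {M : ℤ → ℝ}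
    (hM0 : ∀ i, 0 ≤ M i) (hM : ∀ i, ∀ z ∈ Set.uIcc (Y i) (Y (i + 1)), w z ≤ M i) :
    energy w ε δ (interp Y (ε * δ)) ≤
      ∑' i : ℤ, ENNReal.ofReal ((Y (i + 1) - Y i) ^ 2 / δ + δ * M i) := by
  have hρ : 0 < ε * δ := mul_pos hε hδ
  rw [energy_eq_lintegral hε (isPiecewiseAffine_interp hρ)]
  have hcover : (⋃ i : ℤ, Set.Icc ((i : ℝ) * (ε * δ)) (((i : ℝ) + 1) * (ε * δ))) = Set.univ :=
    Set.eq_univ_of_forall fun x => by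
      obtain ⟨i, h1, h2⟩ := exists_int_mem_Ico hρ x
      exact Set.mem_iUnion.2 ⟨i, h1, h2.le⟩
  rw [← setLIntegral_univ, ← hcover]
  refine (lintegral_iUnion_le _ _).trans (ENNReal.tsum_le_tsum fun i => ?_)
  rw [← setLIntegral_congr Ioo_ae_eq_Icc]
  set q := ε * ((Y (i + 1) - Y i) / (ε * δ)) ^ 2 + ε⁻¹ * M i with hq
  calc ∫⁻ x in Set.Ioo ((i : ℝ) * (ε * δ)) (((i : ℝ) + 1) * (ε * δ)),
        energyDensity w ε (interp Y (ε * δ)) x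
      ≤ ∫⁻ _ in Set.Ioo ((i : ℝ) * (ε * δ)) (((i : ℝ) + 1) * (ε * δ)), ENNReal.ofReal q := by
        refine setLIntegral_mono measurable_const fun x hx => ?_
        rw [energyDensity, deriv_interp hρ hx, hq, ENNReal.ofReal_add (by positivity)
          (mul_nonneg (inv_pos.2 hε).le (hM0 i))]
        gcongr
        exact hM i _ (interp_mem_uIcc hρ ⟨hx.1.le, hx.2.le⟩)
    _ = ENNReal.ofReal ((Y (i + 1) - Y i) ^ 2 / δ + δ * M i) := by
        rw [setLIntegral_const, Real.volume_Ioo, ← ENNReal.ofReal_mul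
          (add_nonneg (by positivity) (mul_nonneg (inv_pos.2 hε).le (hM0 i)))]
        congr 1
        field_simp; ring

end Interp

/-- Gluing of two one-sided sequences at the cell `[j, j+1]`. -/
def twoSided {α : Type*} (j : ℤ) (yL yR : ℕ → α) (i : ℤ) : α :=
  if i ≤ j then yL (j - i).toNat else yR (i - j - 1).toNat

section TwoSided

variable {α : Type*} {j : ℤ} {yL yR : ℕ → α}

theorem twoSided_left (n : ℕ) : twoSided j yL yR (j - n) = yL n := by
  rw [twoSided, if_pos (by omega)]; congr 1; omega

theorem twoSided_right (n : ℕ) : twoSided j yL yR (j + 1 + n) = yR n := by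
  rw [twoSided, if_neg (by omega)]; congr 1; omega

theorem exists_left {i : ℤ} (h : i ≤ j) : ∃ n : ℕ, i = j - n := ⟨(j - i).toNat, by omega⟩

theorem exists_right {i : ℤ} (h : j < i) : ∃ n : ℕ, i = j + 1 + n := ⟨(i - j - 1).toNat, by omega⟩

end TwoSided

theorem tsum_int_eq_left_add_right (F : ℤ → ℝ≥0∞) (j : ℤ) :
    ∑' i, F i = (∑' n : ℕ, F (j + 1 + n)) + F j + ∑' n : ℕ, F (j - (n + 1)) := by
  rw [← (Equiv.addLeft j).tsum_eq F,
    tsum_of_nat_of_neg_add_one ENNReal.summable ENNReal.summable,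
    tsum_eq_zero_add' ENNReal.summable]
  simp only [Equiv.coe_addLeft]
  rw [add_comm (F _)]
  congr 2
  · refine tsum_congr fun n => ?_
    congr 1; push_cast; ring
  · simp

theorem tsum_ofReal_le_of_sum_range_le {f : ℕ → ℝ} (hf : ∀ n, 0 ≤ f n) {N : ℕ}
    (hN : ∀ n, N ≤ n → f n = 0) {B : ℝ} (hB : ∑ n ∈ Finset.range N, f n ≤ B) :
    ∑' n, ENNReal.ofReal (f n) ≤ ENNReal.ofReal B := by
  rw [tsum_eq_sum (s := Finset.range N) fun n hn => by
    rw [hN n (by simpa using hn), ENNReal.ofReal_zero],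
    ← ENNReal.ofReal_sum_of_nonneg fun n _ => hf n]
  exact ENNReal.ofReal_le_ofReal hB

/-- By monotonicity of p, splitting a transition at an intermediate value costs nothing. -/
theorem IsPeriodicWell.abs_primitive_add {w : ℝ → ℝ} (hw : IsPeriodicWell w) {d : ℤ} {m : ℝ}
    (hm : m ∈ Set.uIcc 0 (d : ℝ)) :
    |primitive w 0 - primitive w m| + |primitive w d - primitive w m| = primitive w 1 * |(d : ℝ)| := by
  have hp0 : primitive w 0 = 0 := by simp [primitive]
  have hpm := hw.strictMono_primitive.monotone
  have hd := hw.primitive_int d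
  have h1 := hw.primitive_one_pos
  rw [Set.mem_uIcc] at hm
  rcases hm with ⟨ha, hb⟩ | ⟨ha, hb⟩
  · have e1 := hpm ha
    have e2 := hpm hb
    rw [abs_of_nonneg (ha.trans hb), abs_of_nonpos (by linarith), abs_of_nonneg (by linarith)]
    linarith
  · have e1 := hpm ha
    have e2 := hpm hb
    rw [abs_of_nonpos (ha.trans hb), abs_of_nonneg (by linarith), abs_of_nonpos (by linarith)]
    linarith

/-- Grid-affine transition from `0` to the integer `d` across `t`, of almost optimal energy, which
stays between `0` and `m` to the left and between `m` and `d` to the right of `t`. -/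
theorem IsPeriodicWell.exists_transition {w : ℝ → ℝ} (hw : IsPeriodicWell w) (d : ℤ) {m : ℝ}
    (hm : m ∈ Set.uIcc 0 (d : ℝ)) {κ : ℝ} (hκ : 0 < κ) :
    ∃ Tm : ℝ, 0 < Tm ∧ ∃ δ₀ : ℝ, 0 < δ₀ ∧ ∀ ε δ t : ℝ, 0 < ε → 0 < δ → δ < δ₀ → ∃ u : ℝ → ℝ,
      IsPiecewiseAffine (ε * δ) u ∧
      energy w ε δ u ≤ ENNReal.ofReal (primitive w 1 * |(d : ℝ)| + κ) ∧
      (∀ x, x ≤ t → u x ∈ Set.uIcc 0 m) ∧ (∀ x, t ≤ x → u x ∈ Set.uIcc m d) ∧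
      (∀ x, x ≤ t - ε * Tm → u x = 0) ∧ (∀ x, t + ε * Tm ≤ x → u x = d) := by
  obtain ⟨TL, hTL, δL, hδL, HL⟩ := hw.exists_discrete_transition m (c := 0)
    (by simpa using hw.int_eq_zero 0) (κ := κ / 3) (by positivity)
  obtain ⟨TR, hTR, δR, hδR, HR⟩ := hw.exists_discrete_transition m (c := d)
    (hw.int_eq_zero d) (κ := κ / 3) (by positivity)
  obtain ⟨S, hS, hwS⟩ := hw.exists_bound
  -- The added δL absorbs the width of the cell containing t; κ/(3S) makes the energy of that cell,
  -- where the profile is constant, at most κ/3.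
  refine ⟨max TL TR + δL, by positivity, min δL (min δR (κ / (3 * S))), by positivity,
    fun ε δ t hε hδ hδ₀ => ?_⟩
  have hδL' := hδ₀.trans_le (min_le_left _ _)
  have hδ₁ := hδ₀.trans_le (min_le_right _ _)
  have hδR' := hδ₁.trans_le (min_le_left _ _)
  have hδS : δ * S ≤ κ / 3 := by
    have := (lt_div_iff₀ (by positivity)).1 (hδ₁.trans_le (min_le_right δR (κ / (3 * S))))
    linarith
  obtain ⟨yL, NL, ML, hL0, hL1, hL2, hL3, hL4, hL5, hL6⟩ := HL δ hδ hδL'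
  obtain ⟨yR, NR, MR, hR0, hR1, hR2, hR3, hR4, hR5, hR6⟩ := HR δ hδ hδR'
  have hρ : 0 < ε * δ := mul_pos hε hδ
  -- The point t need not lie on the grid: the profile equals m on the whole cell containing t, and
  -- the two one-sided sequences run outward from its endpoints.
  obtain ⟨j, hj1, hj2⟩ := exists_int_mem_Ico hρ t
  set Y := twoSided j yL yR with hY
  -- Here the index counts cells, not nodes: the left bounds end at cell j - 1, and cell j carries w
  -- m ahead of the right bounds.
  set M := twoSided (j - 1) ML (fun n => if n = 0 then w m else MR (n - 1)) with hMdef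
  have hYL : ∀ n : ℕ, Y (j - n) = yL n := twoSided_left
  have hYR : ∀ n : ℕ, Y (j + 1 + n) = yR n := twoSided_right
  have hYj : Y j = m := by simpa [hL0] using hYL 0
  have hYj1 : Y (j + 1) = m := by simpa [hR0] using hYR 0
  have hML : ∀ n : ℕ, M (j - (n + 1)) = ML n := fun n => by
    have := twoSided_left (j := j - 1) (yL := ML)
      (yR := fun n => if n = 0 then w m else MR (n - 1)) n
    rw [← this, hMdef]; congr 1; ring
  have hMR : ∀ n : ℕ, M (j + 1 + n) = MR n := fun n => by
    have := twoSided_right (j := j - 1) (yL := ML)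
      (yR := fun n => if n = 0 then w m else MR (n - 1)) (n + 1)
    simp only [Nat.add_eq_zero_iff, one_ne_zero, and_false, if_false, Nat.add_sub_cancel] at this
    rw [← this, hMdef]; congr 1; push_cast; ring
  have hMj : M j = w m := by
    have := twoSided_right (j := j - 1) (yL := ML)
      (yR := fun n => if n = 0 then w m else MR (n - 1)) 0
    simp only [if_true] at this
    rw [← this, hMdef]; congr 1; push_cast; ring
  have hYL' : ∀ n : ℕ, Y (j - (n + 1)) = yL (n + 1) ∧ Y (j - (n + 1) + 1) = yL n := fun n => by
    refine ⟨by rw [← hYL]; push_cast; rfl, by rw [← hYL]; congr 1; ring⟩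
  have hYR' : ∀ n : ℕ, Y (j + 1 + n + 1) = yR (n + 1) := fun n => by
    rw [← hYR]; congr 1; push_cast; ring
  have hcases : ∀ i : ℤ, (∃ n : ℕ, i = j - (n + 1)) ∨ i = j ∨ ∃ n : ℕ, i = j + 1 + n := fun i => by
    rcases lt_trichotomy i j with h | h | h
    · exact Or.inl ⟨(j - i - 1).toNat, by omega⟩
    · exact Or.inr (Or.inl h)
    · exact Or.inr (Or.inr (exists_right h))
  have hM0 : ∀ i, 0 ≤ M i := fun i => by
    rcases hcases i with ⟨n, rfl⟩ | rfl | ⟨n, rfl⟩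
    · rw [hML]; exact hL4 n
    · rw [hMj]; exact hw.nonneg m
    · rw [hMR]; exact hR4 n
  have hMw : ∀ i, ∀ z ∈ Set.uIcc (Y i) (Y (i + 1)), w z ≤ M i := fun i => by
    rcases hcases i with ⟨n, rfl⟩ | rfl | ⟨n, rfl⟩
    · rw [hML, (hYL' n).1, (hYL' n).2, Set.uIcc_comm]; exact hL5 n
    · rw [hMj, hYj, hYj1, Set.uIcc_self]; rintro z rfl; exact le_rfl
    · rw [hMR, hYR, hYR']; exact hR5 n
  have hmem : ∀ x, ∃ i : ℤ, x ∈ Set.Icc ((i : ℝ) * (ε * δ)) (((i : ℝ) + 1) * (ε * δ)) ∧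
      x < ((i : ℝ) + 1) * (ε * δ) := fun x => by
    obtain ⟨i, h1, h2⟩ := exists_int_mem_Ico hρ x
    exact ⟨i, ⟨h1, h2.le⟩, h2⟩
  have hlt : ∀ {a b : ℤ}, (a : ℝ) * (ε * δ) < (b : ℝ) * (ε * δ) → a < b := fun h => by
    exact_mod_cast lt_of_mul_lt_mul_right h hρ.le
  have hYmemL : ∀ i, i ≤ j + 1 → Y i ∈ Set.uIcc 0 m := fun i hi => by
    rcases hi.eq_or_lt with rfl | h
    · rw [hYj1]; exact Set.right_mem_uIcc
    · obtain ⟨n, rfl⟩ := exists_left (Int.lt_add_one_iff.1 h)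
      rw [hYL, Set.uIcc_comm]; exact hL2 n
  have hYmemR : ∀ i, j ≤ i → Y i ∈ Set.uIcc m d := fun i hi => by
    rcases hi.eq_or_lt with rfl | h
    · rw [hYj]; exact Set.left_mem_uIcc
    · obtain ⟨n, rfl⟩ := exists_right h
      rw [hYR]; exact hR2 n
  refine ⟨interp Y (ε * δ), isPiecewiseAffine_interp hρ, ?_, fun x hx => ?_, fun x hx => ?_,
    fun x hx => ?_, fun x hx => ?_⟩
  · refine (energy_interp_le hε hδ hM0 hMw).trans ?_
    rw [tsum_int_eq_left_add_right _ j]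
    simp only [hML, hMR, hYR, hYR', hYL', hYj, hYj1, hMj]
    have e1 : ∑' n : ℕ, ENNReal.ofReal ((yR (n + 1) - yR n) ^ 2 / δ + δ * MR n) ≤
        ENNReal.ofReal (|primitive w d - primitive w m| + κ / 3) :=
      tsum_ofReal_le_of_sum_range_le (fun n => by have := hR4 n; positivity) (N := NR)
        (fun n hn => by simp [(hR1 n hn).1, (hR1 n hn).2, (hR1 (n + 1) (by omega)).1]) hR6
    have e2 : ∑' n : ℕ, ENNReal.ofReal ((yL n - yL (n + 1)) ^ 2 / δ + δ * ML n) ≤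
        ENNReal.ofReal (|primitive w 0 - primitive w m| + κ / 3) := by
      refine tsum_ofReal_le_of_sum_range_le (fun n => by have := hL4 n; positivity) (N := NL)
        (fun n hn => by simp [(hL1 n hn).1, (hL1 n hn).2, (hL1 (n + 1) (by omega)).1]) ?_
      refine le_trans (le_of_eq (Finset.sum_congr rfl fun n _ => ?_)) hL6
      ring
    have e3 : ENNReal.ofReal ((m - m) ^ 2 / δ + δ * w m) ≤ ENNReal.ofReal (κ / 3) := by
      refine ENNReal.ofReal_le_ofReal ?_
      have := mul_le_mul_of_nonneg_left (hwS m) hδ.le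
      simp; linarith
    refine (add_le_add (add_le_add e1 e3) e2).trans ?_
    rw [← ENNReal.ofReal_add (by positivity) (by positivity),
      ← ENNReal.ofReal_add (by positivity) (by positivity)]
    refine ENNReal.ofReal_le_ofReal ?_
    have := hw.abs_primitive_add hm
    linarith
  · obtain ⟨i, hi, -⟩ := hmem x
    have hij : i < j + 1 := hlt (by push_cast; linarith [hi.1])
    exact Set.uIcc_subset_uIcc (hYmemL i hij.le) (hYmemL (i + 1) (by omega))
      (interp_mem_uIcc hρ hi)
  · obtain ⟨i, hi, hi'⟩ := hmem x
    have hij : j < i + 1 := hlt (by push_cast; linarith)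
    exact Set.uIcc_subset_uIcc (hYmemR i (by omega)) (hYmemR (i + 1) (by omega))
      (interp_mem_uIcc hρ hi)
  · obtain ⟨i, hi, -⟩ := hmem x
    have h1 : ε * δ + NL * (ε * δ) ≤ ε * (max TL TR + δL) := by
      have : δ + NL * δ ≤ max TL TR + δL := by linarith [le_max_left TL TR]
      have := mul_le_mul_of_nonneg_left this hε.le
      linarith
    have hij : i < j - NL := hlt (by push_cast; linarith [hi.1])
    have hz : ∀ k : ℤ, k ≤ j - NL → Y k = 0 := fun k hk => by
      obtain ⟨n, rfl⟩ := exists_left (i := k) (j := j) (by omega)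
      rw [hYL]; exact (hL1 n (by omega)).1
    have := interp_mem_uIcc (Y := Y) hρ hi
    rw [hz i hij.le, hz (i + 1) (by omega), Set.uIcc_self] at this
    exact this
  · obtain ⟨i, hi, hi'⟩ := hmem x
    have h1 : ε * δ + NR * (ε * δ) ≤ ε * (max TL TR + δL) := by
      have : δ + NR * δ ≤ max TL TR + δL := by linarith [le_max_right TL TR]
      have := mul_le_mul_of_nonneg_left this hε.le
      linarith
    have hij : j + 1 + NR < i + 1 := hlt (by push_cast; linarith)
    have hz : ∀ k : ℤ, j + 1 + NR ≤ k → Y k = d := fun k hk => by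
      obtain ⟨n, rfl⟩ := exists_right (i := k) (j := j) (by omega)
      rw [hYR]; exact (hR1 n (by omega)).1
    have := interp_mem_uIcc (Y := Y) hρ hi
    rw [hz i (by omega), hz (i + 1) (by omega), Set.uIcc_self] at this
    exact this

/-! ### Choosing the split of a jump to respect the L¹ constraint. -/

theorem abs_sub_le_abs_sub_of_le_mid {z b g : ℝ} (hz : z ≤ b) (hg : 2 * g ≤ z + b) :
    |z - g| ≤ |b - g| := by
  rw [abs_le]
  constructor <;> linarith [le_abs_self (b - g)]

/-- The intermediate value at which a jump from `0` to `d` is split can be chosen so that, near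
`t`, transitions are closer to `g` than the sharp jump. -/
theorem exists_split_of_pos {g : ℝ → ℝ} {t : ℝ} (hg : ContinuousAt g t) {d : ℝ} (hd : 0 < d) :
    ∃ m ∈ Set.uIcc 0 d, ∀ᶠ x in 𝓝 t, (∀ z ∈ Set.uIcc 0 m, |z - g x| ≤ |g x|) ∧
      ∀ z ∈ Set.uIcc m d, |z - g x| ≤ |d - g x| := by
  have hL : ∀ {z y : ℝ}, 0 ≤ z → z ≤ 2 * y → |z - y| ≤ |y| := fun {z y} h1 h2 => by
    have := abs_sub_le_abs_sub_of_le_mid (z := -z) (b := 0) (g := -y) (by linarith) (by linarith)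
    rw [← abs_neg] at this
    simpa [sub_eq_add_neg, add_comm] using this
  -- If g t is nearer to 0, the transition is placed entirely right of t, where the sharp value d is
  -- the farthest from g; if nearer to d, entirely left. In the tie it is split at d/2.
  rcases lt_trichotomy (g t) (d / 2) with h | h | h
  · refine ⟨0, Set.left_mem_uIcc, ?_⟩
    filter_upwards [hg.eventually_lt_const h] with x hx
    refine ⟨fun z hz => ?_, fun z hz => ?_⟩
    · rw [Set.uIcc_self, Set.mem_singleton_iff] at hz
      simp [hz]
    · rw [Set.uIcc_of_le hd.le] at hz
      exact abs_sub_le_abs_sub_of_le_mid hz.2 (by linarith [hz.1])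
  · refine ⟨d / 2, by rw [Set.uIcc_of_le hd.le]; constructor <;> linarith, ?_⟩
    filter_upwards [hg.eventually_lt_const (show g t < 3 / 4 * d by linarith),
      hg.eventually_const_lt (show 1 / 4 * d < g t by linarith)] with x hx hx'
    refine ⟨fun z hz => ?_, fun z hz => ?_⟩
    · rw [Set.uIcc_of_le (by linarith)] at hz
      exact hL hz.1 (by linarith [hz.2])
    · rw [Set.uIcc_of_le (by linarith)] at hz
      exact abs_sub_le_abs_sub_of_le_mid hz.2 (by linarith [hz.1])
  · refine ⟨d, Set.right_mem_uIcc, ?_⟩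
    filter_upwards [hg.eventually_const_lt h] with x hx
    refine ⟨fun z hz => ?_, fun z hz => ?_⟩
    · rw [Set.uIcc_of_le hd.le] at hz
      exact hL hz.1 (by linarith [hz.2])
    · rw [Set.uIcc_self, Set.mem_singleton_iff] at hz
      rw [hz]

theorem exists_split {g : ℝ → ℝ} {t : ℝ} (hg : ContinuousAt g t) (d : ℝ) :
    ∃ m ∈ Set.uIcc 0 d, ∀ᶠ x in 𝓝 t, (∀ z ∈ Set.uIcc 0 m, |z - g x| ≤ |g x|) ∧
      ∀ z ∈ Set.uIcc m d, |z - g x| ≤ |d - g x| := by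
  rcases lt_trichotomy d 0 with hd | rfl | hd
  · obtain ⟨m, hm, H⟩ := exists_split_of_pos hg.neg (neg_pos.2 hd)
    have hneg : ∀ {a b z : ℝ}, z ∈ Set.uIcc a b → -z ∈ Set.uIcc (-a) (-b) := by
      intro a b z hz
      rw [Set.mem_uIcc] at hz ⊢
      rcases hz with hz | hz
      · right; constructor <;> linarith [hz.1, hz.2]
      · left; constructor <;> linarith [hz.1, hz.2]
    have habs : ∀ a b : ℝ, |-a - -b| = |a - b| := fun a b => by
      rw [← abs_neg]; congr 1; ring
    refine ⟨-m, by simpa using hneg hm, ?_⟩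
    filter_upwards [H] with x hx
    refine ⟨fun z hz => ?_, fun z hz => ?_⟩
    · have := hx.1 (-z) (by simpa using hneg hz)
      have e : |(-z) - (-g) x| = |z - g x| := habs z (g x)
      rwa [e, Pi.neg_apply, abs_neg] at this
    · have := hx.2 (-z) (by simpa using hneg hz)
      simpa only [Pi.neg_apply, habs] using this
  · refine ⟨0, by simp, Eventually.of_forall fun x => ?_⟩
    simp
  · exact exists_split_of_pos hg hd

/-! ### Superposition of transitions and the recovery sequence. -/

theorem isPiecewiseAffine_const (ρ c : ℝ) : IsPiecewiseAffine ρ fun _ => c :=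
  ⟨continuous_const, fun _ => ⟨0, c, fun _ _ => by simp⟩⟩

theorem IsPiecewiseAffine.add {ρ : ℝ} {f g : ℝ → ℝ} (hf : IsPiecewiseAffine ρ f)
    (hg : IsPiecewiseAffine ρ g) : IsPiecewiseAffine ρ fun x => f x + g x := by
  refine ⟨hf.1.add hg.1, fun i => ?_⟩
  obtain ⟨a, b, h⟩ := hf.2 i
  obtain ⟨a', b', h'⟩ := hg.2 i
  exact ⟨a + a', b + b', fun x hx => by simp only [h x hx, h' x hx]; ring⟩

theorem IsPiecewiseAffine.sum {ρ : ℝ} {ι : Type*} {f : ι → ℝ → ℝ} (s : Finset ι)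
    (hf : ∀ i ∈ s, IsPiecewiseAffine ρ (f i)) : IsPiecewiseAffine ρ fun x => ∑ i ∈ s, f i x := by
  classical
  induction s using Finset.induction_on with
  | empty => simpa using isPiecewiseAffine_const ρ 0
  | insert a s ha ih =>
    simp only [Finset.sum_insert ha]
    exact (hf a (Finset.mem_insert_self a s)).add
      (ih fun i hi => hf i (Finset.mem_insert_of_mem hi))

theorem measurable_energyDensity {w : ℝ → ℝ} (hw : Continuous w) (ε : ℝ) {ξ : ℝ → ℝ}
    (hξ : Continuous ξ) : Measurable (energyDensity w ε ξ) := by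
  have h1 := measurable_deriv ξ
  have h2 := (hw.comp hξ).measurable
  exact ((h1.pow_const 2).const_mul ε).ennreal_ofReal.add (h2.const_mul ε⁻¹).ennreal_ofReal

theorem deriv_eq_zero_of_eventually_const {f : ℝ → ℝ} {t r c₁ c₂ : ℝ}
    (h1 : ∀ y, y ≤ t - r → f y = c₁) (h2 : ∀ y, t + r ≤ y → f y = c₂) {x : ℝ}
    (hx : r < |x - t|) : deriv f x = 0 := by
  rcases lt_abs.1 hx with h | h
  · have : f =ᶠ[𝓝 x] fun _ => c₂ := by
      filter_upwards [lt_mem_nhds (show t + r < x by linarith)] with y hy using h2 y hy.le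
    rw [this.deriv_eq, deriv_const]
  · have : f =ᶠ[𝓝 x] fun _ => c₁ := by
      filter_upwards [gt_mem_nhds (show x < t - r by linarith)] with y hy using h1 y hy.le
    rw [this.deriv_eq, deriv_const]

/-- Superposition of transitions with disjoint supports: the energies add up. -/
theorem energy_superposition_le {w : ℝ → ℝ} (hw : IsPeriodicWell w) {ε δ : ℝ} (hε : 0 < ε)
    (hδ : 0 < δ) (z₀ : ℤ) (T : Finset ℝ) {d : ℝ → ℤ} {r : ℝ}
    (hT : ∀ s ∈ T, ∀ t ∈ T, s < t → 2 * r ≤ t - s) {u : ℝ → ℝ → ℝ} {ϱ : ℝ → ℝ}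
    (hu : ∀ t ∈ T, IsPiecewiseAffine (ε * δ) (u t)) (hϱ : ∀ t ∈ T, ϱ t < r)
    (h1 : ∀ t ∈ T, ∀ x, x ≤ t - ϱ t → u t x = 0) (h2 : ∀ t ∈ T, ∀ x, t + ϱ t ≤ x → u t x = d t) :
    energy w ε δ (fun x => z₀ + ∑ t ∈ T, u t x) ≤ ∑ t ∈ T, energy w ε δ (u t) := by
  have hρ : 0 < ε * δ := mul_pos hε hδ
  have hpa : IsPiecewiseAffine (ε * δ) fun x => z₀ + ∑ t ∈ T, u t x :=
    (isPiecewiseAffine_const _ _).add (IsPiecewiseAffine.sum T hu)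
  have hsum : ∑ t ∈ T, energy w ε δ (u t) = ∫⁻ x, ∑ t ∈ T, energyDensity w ε (u t) x := by
    rw [lintegral_finsetSum _ fun t ht => measurable_energyDensity hw.continuous ε (hu t ht).1]
    exact Finset.sum_congr rfl fun t ht => energy_eq_lintegral hε (hu t ht)
  rw [hsum, energy_eq_lintegral hε hpa]
  refine lintegral_mono_ae ?_
  filter_upwards [(countable_lattice (ε * δ)).ae_notMem volume] with x hx
  have hder : deriv (fun x => (z₀ : ℝ) + ∑ t ∈ T, u t x) x = ∑ t ∈ T, deriv (u t) x :=
    ((HasDerivAt.fun_sum fun t ht => (hu t ht).hasDerivAt hρ hx).const_add _).deriv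
  have hfar : ∀ t ∈ T, r ≤ |x - t| → deriv (u t) x = 0 ∧ ∃ z : ℤ, u t x = z := by
    intro t ht hxt
    have hlt := (hϱ t ht).trans_le hxt
    refine ⟨deriv_eq_zero_of_eventually_const (h1 t ht) (h2 t ht) hlt, ?_⟩
    rcases lt_abs.1 hlt with h | h
    · exact ⟨d t, h2 t ht x (by linarith)⟩
    · exact ⟨0, by rw [h1 t ht x (by linarith), Int.cast_zero]⟩
  have hints : ∀ S : Finset ℝ, (∀ t ∈ S, ∃ z : ℤ, u t x = z) → ∃ z : ℤ, ∑ t ∈ S, u t x = z := by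
    intro S hS
    choose! n hn using hS
    exact ⟨∑ t ∈ S, n t, by push_cast; exact Finset.sum_congr rfl hn⟩
  -- At most one transition is active at x. The others are locally constant and integer there, so
  -- periodicity of w removes them from the density.
  by_cases hnear : ∃ t ∈ T, |x - t| < r
  · obtain ⟨t, ht, hxt⟩ := hnear
    have hother : ∀ s ∈ T.erase t, r ≤ |x - s| := by
      intro s hs
      rw [Finset.mem_erase] at hs
      by_contra! hlt
      have a1 := abs_lt.1 hxt
      have a2 := abs_lt.1 hlt
      rcases lt_or_gt_of_ne hs.1 with h | h
      · linarith [hT s hs.2 t ht h]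
      · linarith [hT t ht s hs.2 h]
    obtain ⟨z, hz⟩ := hints (T.erase t) fun s hs =>
      (hfar s (Finset.mem_of_mem_erase hs) (hother s hs)).2
    have hd0 : ∑ s ∈ T.erase t, deriv (u s) x = 0 := Finset.sum_eq_zero fun s hs =>
      (hfar s (Finset.mem_of_mem_erase hs) (hother s hs)).1
    have e : energyDensity w ε (fun x => (z₀ : ℝ) + ∑ t ∈ T, u t x) x = energyDensity w ε (u t) x := by
      rw [energyDensity, energyDensity, hder, ← Finset.add_sum_erase T _ ht,
        ← Finset.add_sum_erase T _ ht, hd0, hz, add_zero]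
      have : (z₀ : ℝ) + (u t x + z) = u t x + (z₀ + z : ℤ) := by push_cast; ring
      rw [this, hw.add_int]
    rw [e]
    exact Finset.single_le_sum (f := fun t => energyDensity w ε (u t) x) (fun _ _ => zero_le) ht
  · push Not at hnear
    obtain ⟨z, hz⟩ := hints T fun t ht => (hfar t ht (hnear t ht)).2
    have hd0 : ∑ s ∈ T, deriv (u s) x = 0 := Finset.sum_eq_zero fun s hs =>
      (hfar s hs (hnear s hs)).1
    rw [energyDensity, hder, hd0, hz, ← Int.cast_add, hw.int_eq_zero]
    simp

theorem integerStep_eq_sum_ite (z₀ : ℤ) (T : Finset ℝ) (d : ℝ → ℤ) (x : ℝ) :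
    (integerStep z₀ T d x : ℝ) = z₀ + ∑ t ∈ T, if t < x then (d t : ℝ) else 0 := by
  rw [integerStep, Finset.sum_filter]
  push_cast; rfl

/-- Recovery at a fixed accuracy. -/
theorem IsPeriodicWell.eventually_exists_recovery {w : ℝ → ℝ} (hw : IsPeriodicWell w)
    {ε δ : ℕ → ℝ} (hε : ∀ n, 0 < ε n) (hδ : ∀ n, 0 < δ n) (hε0 : Tendsto ε atTop (𝓝 0))
    (hδ0 : Tendsto δ atTop (𝓝 0)) {v : ℝ → ℝ} (hv : Continuous v) (z₀ : ℤ) (T : Finset ℝ)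
    (d : ℝ → ℤ) {κ : ℝ} (hκ : 0 < κ) :
    ∀ᶠ n in atTop, ∃ u : ℝ → ℝ, Continuous u ∧
      energy w (ε n) (δ n) u ≤ ∑ t ∈ T, ENNReal.ofReal (primitive w 1 * |(d t : ℝ)| + κ) ∧
      (∀ x, x ∉ T → |u x - v x| ≤ |integerStep z₀ T d x - v x|) ∧
      ∀ x, (∀ t ∈ T, κ ≤ |x - t|) → u x = integerStep z₀ T d x := by
  -- The value of the step function just left of t; subtracting it from v reduces the jump at t to
  -- one from 0 to d t.
  set a : ℝ → ℤ := fun t => z₀ + ∑ s ∈ T with s < t, d s with ha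
  have hsplit := fun t : ℝ => exists_split (g := fun x => v x - a t)
    (hv.sub continuous_const).continuousAt (t := t) (d t)
  choose m hm hmr using hsplit
  have hball := fun t => Metric.eventually_nhds_iff.1 (hmr t)
  choose q hq0 hq using hball
  have htrans := fun t => hw.exists_transition (d t) (hm t) hκ
  choose Tm hTm δ₀ hδ₀ H using htrans
  obtain ⟨g, hg, hgap⟩ := exists_pos_gap T
  obtain ⟨r, hr0, hrg, hrκ, hrq⟩ : ∃ r : ℝ, 0 < r ∧ 2 * r ≤ g ∧ r ≤ κ ∧ ∀ t ∈ T, r ≤ q t := by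
    have h1 : ∀ᶠ r in 𝓝[>] (0 : ℝ), ∀ t ∈ T, r ≤ q t := (eventually_all_finset T).2 fun t _ => by
      filter_upwards [Ioc_mem_nhdsGT (hq0 t)] with r hr using hr.2
    have h6 : ∀ᶠ r in 𝓝[>] (0 : ℝ), r ∈ Set.Ioc 0 (g / 2) := Ioc_mem_nhdsGT (half_pos hg)
    have h7 : ∀ᶠ r in 𝓝[>] (0 : ℝ), r ∈ Set.Ioc 0 κ := Ioc_mem_nhdsGT hκ
    obtain ⟨r, ⟨⟨h2, h3⟩, h4⟩, h5⟩ := (((h6.and h7).and h1).and self_mem_nhdsWithin).exists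
    exact ⟨r, h5, by linarith [h2.2], h3.2, h4⟩
  have hev : ∀ᶠ n in atTop, ∀ t ∈ T, ε n * Tm t < r ∧ δ n < δ₀ t :=
    (eventually_all_finset T).2 fun t _ => by
      have h1 : Tendsto (fun n => ε n * Tm t) atTop (𝓝 0) := by simpa using hε0.mul_const (Tm t)
      exact (h1.eventually_lt_const hr0).and (hδ0.eventually_lt_const (hδ₀ t))
  filter_upwards [hev] with n hn
  have hU : ∀ t, ∃ u : ℝ → ℝ, t ∈ T → IsPiecewiseAffine (ε n * δ n) u ∧
      energy w (ε n) (δ n) u ≤ ENNReal.ofReal (primitive w 1 * |(d t : ℝ)| + κ) ∧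
      (∀ x, x ≤ t → u x ∈ Set.uIcc 0 (m t)) ∧ (∀ x, t ≤ x → u x ∈ Set.uIcc (m t) (d t)) ∧
      (∀ x, x ≤ t - ε n * Tm t → u x = 0) ∧ (∀ x, t + ε n * Tm t ≤ x → u x = d t) := by
    intro t
    by_cases ht : t ∈ T
    · obtain ⟨u, hu⟩ := H t (ε n) (δ n) t (hε n) (hδ n) (hn t ht).2
      exact ⟨u, fun _ => hu⟩
    · exact ⟨0, fun h => absurd h ht⟩
  choose u hu using hU
  have hsep : ∀ s ∈ T, ∀ t ∈ T, s < t → 2 * r ≤ t - s := fun s hs t ht hst =>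
    hrg.trans (hgap s hs t ht hst)
  have hpa : IsPiecewiseAffine (ε n * δ n) fun x => (z₀ : ℝ) + ∑ t ∈ T, u t x :=
    (isPiecewiseAffine_const _ _).add (IsPiecewiseAffine.sum T fun t ht => (hu t ht).1)
  have hfar : ∀ t ∈ T, ∀ x, r ≤ |x - t| → u t x = if t < x then (d t : ℝ) else 0 := by
    intro t ht x hx
    rcases lt_abs.1 ((hn t ht).1.trans_le hx) with h | h
    · have hpos := mul_pos (hε n) (hTm t)
      rw [if_pos (by linarith)]; exact (hu t ht).2.2.2.2.2 x (by linarith)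
    · have hpos := mul_pos (hε n) (hTm t)
      rw [if_neg (by linarith)]; exact (hu t ht).2.2.2.2.1 x (by linarith)
  have hout : ∀ x, (∀ t ∈ T, r ≤ |x - t|) →
      (z₀ : ℝ) + ∑ t ∈ T, u t x = integerStep z₀ T d x := by
    intro x hx
    rw [integerStep_eq_sum_ite]
    congr 1
    exact Finset.sum_congr rfl fun t ht => hfar t ht x (hx t ht)
  refine ⟨fun x => z₀ + ∑ t ∈ T, u t x, hpa.1, ?_, fun x hxT => ?_, fun x hx => ?_⟩
  · refine (energy_superposition_le hw (hε n) (hδ n) z₀ T hsep (ϱ := fun t => ε n * Tm t)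
      (fun t ht => (hu t ht).1) (fun t ht => (hn t ht).1) (fun t ht => (hu t ht).2.2.2.2.1)
      (fun t ht => (hu t ht).2.2.2.2.2)).trans ?_
    exact Finset.sum_le_sum fun t ht => (hu t ht).2.1
  · by_cases hnear : ∃ t ∈ T, |x - t| < r
    · obtain ⟨t, ht, hxt⟩ := hnear
      have hx' := abs_lt.1 hxt
      have hother : ∀ s ∈ T.erase t, u s x = if s < t then (d s : ℝ) else 0 := by
        intro s hs
        rw [Finset.mem_erase] at hs
        rcases lt_or_gt_of_ne hs.1 with h | h
        · have h3 := hsep s hs.2 t ht h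
          rw [hfar s hs.2 x (by rw [le_abs]; left; linarith), if_pos h, if_pos (by linarith)]
        · have h3 := hsep t ht s hs.2 h
          rw [hfar s hs.2 x (by rw [le_abs]; right; linarith), if_neg (by linarith),
            if_neg (by linarith)]
      have hother' : ∀ s ∈ T.erase t, (if s < x then (d s : ℝ) else 0) =
          if s < t then (d s : ℝ) else 0 := by
        intro s hs
        rw [Finset.mem_erase] at hs
        rcases lt_or_gt_of_ne hs.1 with h | h
        · have h3 := hsep s hs.2 t ht h
          rw [if_pos h, if_pos (by linarith)]
        · have h3 := hsep t ht s hs.2 h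
          rw [if_neg (by linarith), if_neg (by linarith)]
      have hat : (a t : ℝ) = z₀ + ∑ s ∈ T.erase t, if s < t then (d s : ℝ) else 0 := by
        have := integerStep_eq_sum_ite z₀ T d t
        rw [← Finset.add_sum_erase T _ ht, if_neg (lt_irrefl t), zero_add] at this
        exact this
      have e1 : (z₀ : ℝ) + ∑ t ∈ T, u t x - v x = u t x - (v x - a t) := by
        rw [← Finset.add_sum_erase T _ ht, Finset.sum_congr rfl hother, hat]; ring
      have e2 : (integerStep z₀ T d x : ℝ) - v x = (if t < x then (d t : ℝ) else 0) - (v x - a t) := by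
        rw [integerStep_eq_sum_ite, ← Finset.add_sum_erase T _ ht, Finset.sum_congr rfl hother',
          hat]
        ring
      have hqx := hq t (y := x) (by rw [Real.dist_eq]; exact hxt.trans_le (hrq t ht))
      rw [e1, e2]
      rcases lt_or_gt_of_ne (fun h : x = t => hxT (h ▸ ht)) with h | h
      · rw [if_neg h.not_gt, zero_sub, abs_neg]
        exact hqx.1 _ ((hu t ht).2.2.1 x h.le)
      · rw [if_pos h]
        exact hqx.2 _ ((hu t ht).2.2.2.1 x h.le)
    · push Not at hnear
      simp only [hout x hnear, le_refl]
  · exact hout x fun t ht => hrκ.trans (hx t ht)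

/-- At index n, use the best accuracy k ≤ n that is attainable there; x₀ is the fallback when the
selected accuracy is not attainable. -/
theorem exists_diagonal {α : Type*} {P : ℕ → ℕ → α → Prop}
    (hanti : ∀ k l n x, k ≤ l → P l n x → P k n x) (hev : ∀ k, ∀ᶠ n in atTop, ∃ x, P k n x) (x₀ : α) :
    ∃ u : ℕ → α, (∀ n, u n = x₀ ∨ ∃ k, P k n (u n)) ∧ ∀ k, ∀ᶠ n in atTop, P k n (u n) := by
  classical
  set K : ℕ → ℕ := fun n => Nat.findGreatest (fun k => ∃ x, P k n x) n with hK
  refine ⟨fun n => if h : ∃ x, P (K n) n x then h.choose else x₀, fun n => ?_, fun k => ?_⟩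
  · by_cases h : ∃ x, P (K n) n x
    · right; exact ⟨K n, by simp only [dif_pos h]; exact h.choose_spec⟩
    · left; exact dif_neg h
  · filter_upwards [hev k, eventually_ge_atTop k] with n hn hkn
    have h : ∃ x, P (K n) n x := Nat.findGreatest_spec (P := fun k => ∃ x, P k n x) hkn hn
    simp only [dif_pos h]
    exact hanti k (K n) n _ (Nat.le_findGreatest hkn hn) h.choose_spec

/-- Pointwise domination preserves the L¹ constraint with the same constant, even when ξ attains the
bound. -/
theorem mem_ambient_of_abs_le {v ξ u : ℝ → ℝ} {C : ℝ} (hv : Continuous v) (hξ : ξ ∈ ambient v C)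
    (hu : Continuous u) (h : ∀ᵐ x, |u x - v x| ≤ |ξ x - v x|) : u ∈ ambient v C := by
  have hi : Integrable fun x => u x - v x :=
    hξ.1.mono (hu.sub hv).aestronglyMeasurable h
  exact ⟨hi, (integral_mono_ae hi.abs hξ.1.abs h).trans hξ.2⟩

theorem tendstoL1loc_of_abs_le {v ξ : ℝ → ℝ} {u : ℕ → ℝ → ℝ} {C : ℝ} (hξ : ξ ∈ ambient v C)
    (hu : ∀ n, u n ∈ ambient v C) (h : ∀ n, ∀ᵐ x, |u n x - v x| ≤ |ξ x - v x|)
    (hlim : ∀ᵐ x, Tendsto (fun n => u n x) atTop (𝓝 (ξ x))) : TendstoL1loc u ξ := by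
  intro K _
  have hdiff : ∀ n, Integrable fun x => u n x - ξ x := fun n => by
    have := (hu n).1.sub hξ.1
    refine this.congr (ae_of_all _ fun x => ?_)
    simp
  have := tendsto_lintegral_of_dominated_convergence' (μ := volume.restrict K)
    (F := fun n x => ENNReal.ofReal |u n x - ξ x|) (f := fun _ => 0)
    (fun x => ENNReal.ofReal (2 * |ξ x - v x|))
    (fun n => ((hdiff n).abs.aestronglyMeasurable.aemeasurable.ennreal_ofReal).restrict)
    (fun n => ae_restrict_of_ae ?_) ?_ (ae_restrict_of_ae ?_)
  · simpa using this
  · filter_upwards [h n] with x hx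
    refine ENNReal.ofReal_le_ofReal ?_
    have := abs_sub (u n x - v x) (ξ x - v x)
    rw [sub_sub_sub_cancel_right] at this
    linarith
  · exact (((hξ.1.abs.const_mul 2).restrict).lintegral_lt_top).ne
  · filter_upwards [hlim] with x hx
    have h1 : Tendsto (fun n => |u n x - ξ x|) atTop (𝓝 0) := by
      simpa using (hx.sub_const (ξ x)).abs
    simpa [Function.comp_def] using (ENNReal.continuous_ofReal.tendsto 0).comp h1

/-- The `limsup` inequality. -/
theorem exists_recovery_sequence {w : ℝ → ℝ} (hw : IsPeriodicWell w)
    {ε δ : ℕ → ℝ} (hε : ∀ n, 0 < ε n) (hδ : ∀ n, 0 < δ n) (hε0 : Tendsto ε atTop (𝓝 0))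
    (hδ0 : Tendsto δ atTop (𝓝 0)) {v : ℝ → ℝ} (hv : Continuous v) {C : ℝ} {ξ : ℝ → ℝ}
    (hξ : ξ ∈ ambient v C) :
    ∃ u : ℕ → ℝ → ℝ, (∀ n, u n ∈ ambient v C) ∧ TendstoL1loc u ξ ∧
      limsup (fun n => energy w (ε n) (δ n) (u n)) atTop ≤ limitEnergy w ξ := by
  by_cases hBV : IsIntegerBV ξ
  swap
  · refine ⟨fun _ => ξ, fun _ => hξ, fun K _ => by simp, ?_⟩
    rw [limitEnergy, if_neg hBV]
    exact le_top
  obtain ⟨z₀, T, d, hstep, hTV⟩ := hBV.exists_integerStep (locallyIntegrable_of_mem_ambient hv hξ)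
  set P : ℕ → ℕ → (ℝ → ℝ) → Prop := fun k n u => Continuous u ∧
      energy w (ε n) (δ n) u ≤
        ∑ t ∈ T, ENNReal.ofReal (primitive w 1 * |(d t : ℝ)| + 1 / ((k : ℝ) + 1)) ∧
      (∀ x, x ∉ T → |u x - v x| ≤ |integerStep z₀ T d x - v x|) ∧
      ∀ x, (∀ t ∈ T, 1 / ((k : ℝ) + 1) ≤ |x - t|) → u x = integerStep z₀ T d x with hP
  have hanti : ∀ k l n u, k ≤ l → P l n u → P k n u := by
    intro k l n u hkl ⟨h1, h2, h3, h4⟩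
    have hle : 1 / ((l : ℝ) + 1) ≤ 1 / ((k : ℝ) + 1) := Nat.one_div_le_one_div hkl
    refine ⟨h1, h2.trans ?_, h3, fun x hx => h4 x fun t ht => hle.trans (hx t ht)⟩
    gcongr
  obtain ⟨u, hu, hu'⟩ := exists_diagonal hanti (fun k => hw.eventually_exists_recovery hε hδ hε0 hδ0
    hv z₀ T d (κ := 1 / ((k : ℝ) + 1)) (by positivity)) ξ
  have haeT : ∀ᵐ x, x ∉ T := T.countable_toSet.ae_notMem volume
  have hle : ∀ n, ∀ᵐ x, |u n x - v x| ≤ |ξ x - v x| := by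
    intro n
    rcases hu n with h | ⟨k, hk⟩
    · exact ae_of_all _ fun x => by rw [h]
    · filter_upwards [haeT, hstep] with x hx hx'
      rw [hx']; exact hk.2.2.1 x hx
  have hmem : ∀ n, u n ∈ ambient v C := by
    intro n
    rcases hu n with h | ⟨k, hk⟩
    · rw [h]; exact hξ
    · exact mem_ambient_of_abs_le hv hξ hk.1 (hle n)
  refine ⟨u, hmem, tendstoL1loc_of_abs_le hξ hmem hle ?_, ?_⟩
  · filter_upwards [haeT, hstep] with x hx hx'
    -- Off T, x eventually lies outside every transition window, so u n x equals ξ x for all large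
    -- n.
    have h1 : ∀ᶠ κ in 𝓝[>] (0 : ℝ), ∀ t ∈ T, κ ≤ |x - t| :=
      (eventually_all_finset T).2 fun t ht => by
        have : 0 < |x - t| := abs_pos.2 (sub_ne_zero.2 fun h => hx (h ▸ ht))
        filter_upwards [Ioc_mem_nhdsGT this] with κ hκ using hκ.2
    have h2 : Tendsto (fun k : ℕ => 1 / ((k : ℝ) + 1)) atTop (𝓝[>] 0) :=
      tendsto_nhdsWithin_iff.2 ⟨tendsto_one_div_add_atTop_nhds_zero_nat,
        Eventually.of_forall fun k => by simp only [Set.mem_Ioi]; positivity⟩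
    obtain ⟨k, hk⟩ := (h2.eventually h1).exists
    refine tendsto_const_nhds.congr' ?_
    filter_upwards [hu' k] with n hn
    rw [hx']; exact (hn.2.2.2 x hk).symm
  · have hp := hw.primitive_one_pos.le
    have hlim : Tendsto (fun k : ℕ => ∑ t ∈ T,
        ENNReal.ofReal (primitive w 1 * |(d t : ℝ)| + 1 / ((k : ℝ) + 1))) atTop
        (𝓝 (∑ t ∈ T, ENNReal.ofReal (primitive w 1 * |(d t : ℝ)| + 0))) :=
      tendsto_finsetSum _ fun t _ => ENNReal.tendsto_ofReal
        (tendsto_one_div_add_atTop_nhds_zero_nat.const_add _)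
    -- The limsup is below the bound for every accuracy k; letting k → ∞ leaves the sum of p(1)|d
    -- t|, which `hTV` compares with the variation.
    have hbound := ge_of_tendsto hlim (Eventually.of_forall fun k =>
      limsup_le_of_le (by isBoundedDefault) ((hu' k).mono fun n hn => hn.2.1))
    refine hbound.trans ?_
    rw [limitEnergy, if_pos hBV]
    simp only [add_zero, ENNReal.ofReal_mul hp, ← Finset.mul_sum]
    gcongr

end DomainWall

theorem theorem2 (h : ℝ → ℝ) (σ : ℝ) (hh : DomainWall.IsAdmissibleInteraction h σ)
    (ml mr : ℤ) (hm : ml ≠ mr) (v : ℝ → ℝ) (hv : DomainWall.IsProfile ml mr v)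
    (Cbar : ℝ) (hC : 0 < Cbar)
    (ε δ : ℕ → ℝ) (hε : ∀ n, 0 < ε n) (hδ : ∀ n, 0 < δ n)
    (hε0 : Tendsto ε atTop (𝓝 0)) (hδ0 : Tendsto δ atTop (𝓝 0)) :
    DomainWall.GammaConverges (DomainWall.ambient v Cbar) DomainWall.TendstoL1loc
      (fun n => DomainWall.energy (DomainWall.potential h σ) (ε n) (δ n))
      (DomainWall.limitEnergy (DomainWall.potential h σ)) ∧
    ∀ (C : ℝ) (ξ : ℕ → ℝ → ℝ), 0 < C → (∀ n, ξ n ∈ DomainWall.ambient v Cbar) →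
      (∀ n, DomainWall.energy (DomainWall.potential h σ) (ε n) (δ n) (ξ n) ≤ ENNReal.ofReal C) →
      ∃ (k : ℕ → ℕ) (ξ₀ : ℝ → ℝ), StrictMono k ∧ ξ₀ ∈ DomainWall.ambient v Cbar ∧
        DomainWall.IsIntegerBV ξ₀ ∧ DomainWall.TendstoL1loc (fun n => ξ (k n)) ξ₀ := by
  have hw := hh.isPeriodicWell
  have hvc := hv.contDiff.continuous
  refine ⟨fun ξ₀ hξ₀ => ⟨fun ξ hξ hlim => ?_, ?_⟩, fun C ξ _ hξ hE => ?_⟩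
  · exact DomainWall.limitEnergy_le_liminf hw hε hδ hε0
      (fun n => DomainWall.locallyIntegrable_of_mem_ambient hvc (hξ n))
      (DomainWall.locallyIntegrable_of_mem_ambient hvc hξ₀) hlim
  · exact DomainWall.exists_recovery_sequence hw hε hδ hε0 hδ0 hvc hξ₀
  · exact DomainWall.exists_subseq_tendstoL1loc hw hε hδ hε0 hvc hξ ENNReal.ofReal_ne_top hE
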